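/- **Theorem 6.1 (with its corollaries).** For $z=(x,\omega)\in\mathbb{R}^{2d}$ let $\pi(z)f(t)=e^{2\pi i\omega\cdot t}f(t-x)$ on $L^2(\mathbb{R}^d)$, let $\Omega(z,z')=x'\cdot\omega-x\cdot\omega'$, $Pf(t)=f(-t)$ and $\check S=PSP$. Let $\Lambda\subset\mathbb{R}^{2d}$ be a full-rank lattice with adjoint lattice $\Lambda^\circ=\{z: e^{2\pi i\Omega(z,\lambda)}=1\ \forall\lambda\in\Lambda\}$. A bounded operator $S$ on $L^2(\mathbb{R}^d)$ is $\Lambda$-modulation invariant if $S=e^{-\pi i\lambda_1\cdot\lambda_2/2}\,\pi(\lambda/2)\,S\,\pi(\lambda/2)$ for every $\lambda=(\lambda_1,\lambda_2)\in\Lambda$. The Weyl symbol $\sigma_S$ and the Fourier–Wigner transform $\mathcal F_W(S)$ are the tempered distributions on $\mathbb{R}^{2d}$ determined by $$\langle Sf,g\rangle=\langle\sigma_S,W(g,f)\rangle,\qquad \langle Sf,g\rangle=\langle\mathcal F_W(S),A(g,f)\rangle\qquad(f,g\in\mathscr S(\mathbb{R}^d)),$$ where brackets are antilinear in the second slot,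 $W(f,g)(x,\omega)=\int f(x+\tfrac t2)\overline{g(x-\tfrac t2)}e^{-2\pi i\omega\cdot t}\,dt$ and $A(f,g)(x,\omega)=e^{\pi i x\cdot\omega}\langle f,\pi(x,\omega)g\rangle$. Let $S,T$ be bounded $\Lambda$-modulation invariant operators on $L^2(\mathbb{R}^d)$ and suppose $2\Omega(\lambda^\circ,\mu^\circ)\in\mathbb{Z}$ for all $\lambda^\circ,\mu^\circ\in\Lambda^\circ$. Then $\sigma_S=\sum_{\lambda\in\Lambda^\circ}c_\lambda\delta_\lambda$ and $\sigma_T=\sum_{\mu\in\Lambda^\circ}e_\mu\delta_\mu$ (weak-$*$), the convolution with the reflected symbol $\check\sigma_T=\sum_\mu e_{-\mu}\delta_\mu$ exists, $$\sigma_S*\check\sigma_T=\sum_{\gamma\in\Lambda^\circ}\Big(\sum_{\lambda\in\Lambda^\circ}c_\lambda e_{\lambda-\gamma}\Big)\delta_\gamma$$ with absolutely convergent coefficients, and $$\mathcal F_W(ST)(2z)=2^{2d}\,(\sigma_S*\check\sigma_T)(z)$$ in the sense of point masses: $\mathcal F_W(ST)=\sum_{\gamma\in\Lambda^\circ}2^{2d}\big(\sum_{\lambda}c_\lambda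 e_{\lambda-\gamma}\big)\delta_{2\gamma}$. Equivalently, $\mathcal F_W(ST)$ applied to $\varphi(\cdot/2)$ equals $2^{2d}$ times $\sigma_S*\check\sigma_T$ applied to $\varphi$, for every Schwartz function $\varphi$. Moreover $S\check T=T\check S$, and $\sigma_{ST}$, $\mathcal F_W(S)$, $\mathcal F_W(T)$, $\mathcal F_W(T^*)$ are given by locally integrable functions with (almost everywhere) $$\sigma_{ST}(\tfrac z2)=2^{2d}\,\mathcal F_W(S)(z)\,\mathcal F_W(T)(-z)=2^{2d}\,\mathcal F_W(S)(z)\,\overline{\mathcal F_W(T^*)(z)} .$$ -/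

import Mathlib

open MeasureTheory SchwartzMap
open scoped FourierTransform ContDiff ComplexConjugate InnerProductSpace ENNReal

noncomputable section

namespace ModInv

/-- Configuration space `ℝᵈ`. -/
abbrev Pos (d : ℕ) : Type := EuclideanSpace ℝ (Fin d)
/-- Phase space `ℝᵈ × ℝᵈ = ℝ²ᵈ`, with points `z = (x, ξ)`. -/
abbrev Phase (d : ℕ) : Type := Pos d × Pos d

section Aux

variable {d : ℕ} {F : Type} [NormedAddCommGroup F] [NormedSpace ℂ F]

/-- The partial Fourier integral `(x, ξ) ↦ ∫ exp (-2 π i t · ξ) H (x, t) dt`. -/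
def partialFourierFun (H : 𝓢(Phase d, F)) (z : Phase d) : F :=
  ∫ t : Pos d, 𝐞 (-⟪t, z.2⟫_ℝ) • H (z.1, t)

lemma slice_bound (k : ℕ) (H : 𝓢(Phase d, F)) : ∃ b : Pos d → ℝ, Integrable b ∧
    ∀ x t, ‖x‖ ^ k * ‖H (x, t)‖ ≤ b t := by
  set n := (volume : Measure (Pos d)).integrablePower
  set C := 2 ^ (k + n) * (Finset.Iic (k + n, 0)).sup (fun m => SchwartzMap.seminorm ℝ m.1 m.2) H
  refine ⟨fun t => C * (1 + ‖t‖) ^ (-(n : ℝ)),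
    (Measure.integrable_pow_neg_integrablePower volume).const_mul C, fun x t => ?_⟩
  have h := one_add_le_sup_seminorm_apply (𝕜 := ℝ) (m := (k + n, 0)) (k := k + n) (n := 0)
    le_rfl le_rfl H (x, t)
  rw [norm_iteratedFDeriv_zero] at h
  have h0 : (0 : ℝ) < 1 + ‖t‖ := by positivity
  change _ ≤ C * (1 + ‖t‖) ^ (-(n : ℝ))
  rw [Real.rpow_neg h0.le, Real.rpow_natCast, ← div_eq_mul_inv, le_div_iff₀ (by positivity)]
  refine le_trans ?_ h
  have h1 : ‖x‖ ≤ 1 + ‖(x, t)‖ := by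
    have : ‖x‖ ≤ ‖(x, t)‖ := le_max_left _ _
    linarith
  have h2 : 1 + ‖t‖ ≤ 1 + ‖(x, t)‖ := by
    have : ‖t‖ ≤ ‖(x, t)‖ := le_max_right _ _
    linarith
  calc ‖x‖ ^ k * ‖H (x, t)‖ * (1 + ‖t‖) ^ n = ‖x‖ ^ k * (1 + ‖t‖) ^ n * ‖H (x, t)‖ := by ring
    _ ≤ (1 + ‖(x, t)‖) ^ k * (1 + ‖(x, t)‖) ^ n * ‖H (x, t)‖ := by gcongr
    _ = _ := by rw [pow_add]

lemma slice_integrable (H : 𝓢(Phase d, F)) (x : Pos d) : Integrable (fun t => H (x, t)) := by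
  obtain ⟨b, hb, h⟩ := slice_bound 0 H
  exact hb.mono' (by fun_prop) (.of_forall fun t => by simpa using h x t)

lemma decay_fst (k : ℕ) (H : 𝓢(Phase d, F)) :
    ∃ C, ∀ z, ‖z.1‖ ^ k * ‖partialFourierFun H z‖ ≤ C := by
  obtain ⟨b, hb, h⟩ := slice_bound k H
  refine ⟨∫ t, b t, fun z => ?_⟩
  have e : ‖z.1‖ ^ k * ‖partialFourierFun H z‖ ≤
      ∫ t : Pos d, ‖z.1‖ ^ k * ‖H (z.1, t)‖ := by
    rw [integral_const_mul]
    gcongr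
    refine (norm_integral_le_integral_norm _).trans (le_of_eq ?_)
    simp
  exact e.trans (integral_mono ((slice_integrable H z.1).norm.const_mul _) hb (h z.1))

/-- The derivative of the integrand of `partialFourierFun`, without the phase factor. -/
def derivPart (H : 𝓢(Phase d, F)) : 𝓢(Phase d, Phase d →L[ℝ] F) :=
  postcompCLM ((ContinuousLinearMap.compL ℝ (Phase d) (Phase d) F).flip
      ((ContinuousLinearMap.inl ℝ (Pos d) (Pos d)).comp (ContinuousLinearMap.fst ℝ _ _)))
    (fderivCLM ℝ (Phase d) F H)
  - (2 * Real.pi * Complex.I) • smulRightCLM ℂ F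
      (((innerSL ℝ).comp (ContinuousLinearMap.snd ℝ (Pos d) (Pos d))).flip.comp
        (ContinuousLinearMap.snd ℝ (Pos d) (Pos d))) H

lemma derivPart_apply (H : 𝓢(Phase d, F)) (z v : Phase d) :
    derivPart H z v = fderiv ℝ H z (v.1, 0) -
      (2 * Real.pi * Complex.I * (⟪z.2, v.2⟫_ℝ : ℂ)) • H z := by
  simp [derivPart, mul_smul, real_inner_comm]

lemma hasFDerivAt_integrand (H : 𝓢(Phase d, F)) (z : Phase d) (t : Pos d) :
    HasFDerivAt (fun z : Phase d => 𝐞 (-⟪t, z.2⟫_ℝ) • H (z.1, t))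
      (𝐞 (-⟪t, z.2⟫_ℝ) • derivPart H (z.1, t)) z := by
  have h1 : HasFDerivAt (fun z : Phase d => ((𝐞 (-⟪t, z.2⟫_ℝ) : Circle) : ℂ))
      ((-2 * Real.pi * Complex.I * 𝐞 (-⟪t, z.2⟫_ℝ)) •
        (Complex.ofRealCLM.comp ((innerSL ℝ t).comp (ContinuousLinearMap.snd ℝ (Pos d) (Pos d))))) z := by
    have h2 := (Real.hasFDerivAt_fourierChar_neg_bilinear_right (innerSL ℝ) t z.2).comp z
      (hasFDerivAt_snd (𝕜 := ℝ) (p := z))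
    exact h2
  have h3 : HasFDerivAt (fun z : Phase d => H (z.1, t))
      ((fderiv ℝ H (z.1, t)).comp ((ContinuousLinearMap.inl ℝ (Pos d) (Pos d)).comp
        (ContinuousLinearMap.fst ℝ _ _))) z := by
    refine (H.hasFDerivAt (z.1, t)).comp z ?_
    have := (hasFDerivAt_fst (𝕜 := ℝ) (p := z)).prodMk (hasFDerivAt_const t z)
    refine this.congr_fderiv ?_
    ext v <;> simp
  have h4 := h1.smul h3
  refine h4.congr_fderiv ?_
  refine ContinuousLinearMap.ext fun v => ?_
  have := derivPart_apply H (z.1, t) v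
  simp only [Circle.smul_def, _root_.smul_apply, this]
  simp [smul_smul, sub_eq_add_neg]
  congr 1
  ring

lemma hasFDerivAt_partialFourierFun [CompleteSpace F] (H : 𝓢(Phase d, F)) (z : Phase d) :
    HasFDerivAt (partialFourierFun H) (partialFourierFun (derivPart H) z) z := by
  obtain ⟨b, hb, h⟩ := slice_bound 0 (derivPart H)
  have m : ∀ {G : Type} [NormedAddCommGroup G] [NormedSpace ℂ G] (K : 𝓢(Phase d, G)) (z : Phase d),
      AEStronglyMeasurable (fun t : Pos d => 𝐞 (-⟪t, z.2⟫_ℝ) • K (z.1, t)) volume := by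
    intro G _ _ K z
    exact Continuous.aestronglyMeasurable (by fun_prop)
  have key := hasFDerivAt_integral_of_dominated_of_fderiv_le (𝕜 := ℝ) (μ := (volume : Measure (Pos d)))
    (F := fun (z : Phase d) (t : Pos d) => 𝐞 (-⟪t, z.2⟫_ℝ) • H (z.1, t)) (x₀ := z)
    (F' := fun z t => 𝐞 (-⟪t, z.2⟫_ℝ) • derivPart H (z.1, t)) (bound := b)
    (s := Set.univ) Filter.univ_mem (Filter.Eventually.of_forall fun z => m H z)
    ((slice_integrable H z.1).mono (m H z) (Filter.Eventually.of_forall fun t => by simp)) (m (derivPart H) z)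
    (Filter.Eventually.of_forall fun t z _ => by
      change ‖((𝐞 (-⟪t, z.2⟫_ℝ) : Circle) : ℂ) • derivPart H (z.1, t)‖ ≤ b t
      rw [norm_smul, Circle.norm_coe, one_mul]
      simpa using h z.1 t) hb
    (Filter.Eventually.of_forall fun t z _ => hasFDerivAt_integrand H z t)
  exact key

lemma slice_fderiv (H : 𝓢(Phase d, F)) (x t : Pos d) :
    HasFDerivAt (fun t => H (x, t)) ((fderiv ℝ H (x, t)).comp
      (ContinuousLinearMap.inr ℝ (Pos d) (Pos d))) t := by
  refine (H.hasFDerivAt (x, t)).comp t ?_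
  refine ((hasFDerivAt_const x t).prodMk (hasFDerivAt_id (𝕜 := ℝ) t)).congr_fderiv ?_
  ext v <;> simp

/-- The partial derivative in the second variable. -/
def derivSnd (H : 𝓢(Phase d, F)) : 𝓢(Phase d, Pos d →L[ℝ] F) :=
  postcompCLM ((ContinuousLinearMap.compL ℝ (Pos d) (Phase d) F).flip
      (ContinuousLinearMap.inr ℝ (Pos d) (Pos d))) (fderivCLM ℝ (Phase d) F H)

lemma norm_derivSnd (H : 𝓢(Phase d, F)) (z : Phase d) :
    ‖z.2‖ * ‖partialFourierFun H z‖ ≤ ‖partialFourierFun (derivSnd H) z‖ := by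
  have e : ∀ t, fderiv ℝ (fun t => H (z.1, t)) t = derivSnd H (z.1, t) := fun t => by
    rw [(slice_fderiv H z.1 t).fderiv]; rfl
  have h := Real.fourier_fderiv (slice_integrable H z.1)
    (fun t => (slice_fderiv H z.1 t).differentiableAt)
    (by simpa only [funext e] using slice_integrable (derivSnd H) z.1)
  have h' := congrFun h z.2
  rw [funext e] at h'
  have h5 : partialFourierFun (derivSnd H) z =
    VectorFourier.fourierSMulRight (-innerSL ℝ) (𝓕 fun t => H (z.1, t)) z.2 := h'
  rw [h5, VectorFourier.norm_fourierSMulRight]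
  have h6 : (𝓕 fun t => H (z.1, t)) z.2 = partialFourierFun H z := rfl
  rw [h6]
  have h7 : ‖(-innerSL ℝ) z.2‖ = ‖z.2‖ := by
    rw [_root_.neg_apply, norm_neg]
    exact innerSL_apply_norm ℝ z.2
  rw [h7]
  nlinarith [Real.pi_gt_three, mul_nonneg (norm_nonneg z.2) (norm_nonneg (partialFourierFun H z))]

end Aux

lemma decay_snd {d : ℕ} (k : ℕ) : ∀ {F : Type} [NormedAddCommGroup F] [NormedSpace ℂ F]
    (H : 𝓢(Phase d, F)), ∃ C, ∀ z, ‖z.2‖ ^ k * ‖partialFourierFun H z‖ ≤ C := by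
  induction k with
  | zero =>
    intro F _ _ H
    obtain ⟨b, hb, h⟩ := slice_bound 0 H
    refine ⟨∫ t, b t, fun z => ?_⟩
    rw [pow_zero, one_mul]
    refine norm_integral_le_of_norm_le hb (.of_forall fun t => ?_)
    simpa using h z.1 t
  | succ k ih =>
    intro F _ _ H
    obtain ⟨C, hC⟩ := ih (derivSnd H)
    refine ⟨C, fun z => le_trans ?_ (hC z)⟩
    rw [pow_succ, mul_assoc]
    gcongr
    exact norm_derivSnd H z

lemma decay_all {d : ℕ} (n : ℕ) : ∀ (k : ℕ) {F : Type} [NormedAddCommGroup F] [NormedSpace ℂ F]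
    [CompleteSpace F] (H : 𝓢(Phase d, F)), ∃ C, ∀ z,
    ‖z‖ ^ k * ‖iteratedFDeriv ℝ n (partialFourierFun H) z‖ ≤ C := by
  induction n with
  | zero =>
    intro k F _ _ _ H
    obtain ⟨C₁, h₁⟩ := decay_fst k H
    obtain ⟨C₂, h₂⟩ := decay_snd k H
    refine ⟨max C₁ C₂, fun z => ?_⟩
    rw [norm_iteratedFDeriv_zero]
    rcases max_cases ‖z.1‖ ‖z.2‖ with h | h
    · rw [Prod.norm_def, h.1]; exact (h₁ z).trans (le_max_left _ _)
    · rw [Prod.norm_def, h.1]; exact (h₂ z).trans (le_max_right _ _)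
  | succ n ih =>
    intro k F _ _ _ H
    obtain ⟨C, hC⟩ := ih k (derivPart H)
    refine ⟨C, fun z => ?_⟩
    have e : fderiv ℝ (partialFourierFun H) = partialFourierFun (derivPart H) :=
      funext fun z => (hasFDerivAt_partialFourierFun H z).fderiv
    rw [← norm_iteratedFDeriv_fderiv, e]
    exact hC z

lemma contDiff_partialFourierFun {d : ℕ} (n : ℕ) : ∀ {F : Type} [NormedAddCommGroup F]
    [NormedSpace ℂ F] [CompleteSpace F] (H : 𝓢(Phase d, F)),
    ContDiff ℝ n (partialFourierFun H) := by
  induction n with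
  | zero =>
    intro F _ _ _ H
    rw [Nat.cast_zero, contDiff_zero]
    exact (fun z => (hasFDerivAt_partialFourierFun H z).continuousAt : ∀ z, _) |> continuous_iff_continuousAt.2
  | succ n ih =>
    intro F _ _ _ H
    have e : fderiv ℝ (partialFourierFun H) = partialFourierFun (derivPart H) :=
      funext fun z => (hasFDerivAt_partialFourierFun H z).fderiv
    rw [Nat.cast_succ, contDiff_succ_iff_fderiv]
    refine ⟨fun z => (hasFDerivAt_partialFourierFun H z).differentiableAt, by simp, ?_⟩
    rw [e]
    exact ih _

/-- The partial Fourier transform in the second variable,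
`(x, ξ) ↦ ∫ H (x, t) exp (-2 π i ξ · t) dt`, of a Schwartz function on phase space. -/
def partialFourier {d : ℕ} (H : 𝓢(Phase d, ℂ)) : 𝓢(Phase d, ℂ) where
  toFun := partialFourierFun H
  smooth' := contDiff_infty.2 fun n => contDiff_partialFourierFun n H
  decay' := fun k n => decay_all n k H

lemma tensor_decay {d : ℕ} (f g : 𝓢(Pos d, ℂ)) (k n : ℕ) : ∃ C : ℝ, ∀ z : Phase d,
    ‖z‖ ^ k * ‖iteratedFDeriv ℝ n (fun z : Phase d => f z.1 * g z.2) z‖ ≤ C := by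
  have b : ∀ (h : 𝓢(Pos d, ℂ)) (L : Phase d →L[ℝ] Pos d), ‖L‖ ≤ 1 → ∀ i z,
      ‖iteratedFDeriv ℝ i (fun z => h (L z)) z‖ ≤ ‖iteratedFDeriv ℝ i h (L z)‖ := by
    intro h L hL i z
    have := L.iteratedFDeriv_comp_right (f := h) (h.smooth ⊤) z (i := i) (mod_cast le_top)
    change ‖iteratedFDeriv ℝ i (h ∘ L) z‖ ≤ _
    rw [this]
    refine (ContinuousMultilinearMap.norm_compContinuousLinearMap_le _ _).trans ?_
    refine mul_le_of_le_one_right (norm_nonneg _) ?_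
    simpa using pow_le_one₀ (norm_nonneg L) hL
  choose A hA using fun i => f.decay k i
  choose A' hA' using fun i => f.decay 0 i
  choose B hB using fun i => g.decay k i
  choose B' hB' using fun i => g.decay 0 i
  refine ⟨∑ i ∈ Finset.range (n + 1), (n.choose i : ℝ) *
    (A i * B' (n - i) + A' i * B (n - i)), fun z => ?_⟩
  have h := norm_iteratedFDeriv_mul_le (𝕜 := ℝ) (f := fun z : Phase d => f z.1)
    (g := fun z : Phase d => g z.2) (N := ∞) (n := n)
    ((f.smooth ⊤).comp contDiff_fst) ((g.smooth ⊤).comp contDiff_snd) z (mod_cast le_top)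
  refine (mul_le_mul_of_nonneg_left h (by positivity)).trans ?_
  rw [Finset.mul_sum]
  refine Finset.sum_le_sum fun i _ => ?_
  have h1 := b f (ContinuousLinearMap.fst ℝ _ _) (ContinuousLinearMap.norm_fst_le ..) i z
  have h2 := b g (ContinuousLinearMap.snd ℝ _ _) (ContinuousLinearMap.norm_snd_le ..) (n - i) z
  simp only [ContinuousLinearMap.coe_fst', ContinuousLinearMap.coe_snd'] at h1 h2
  have hz : ‖z‖ ^ k ≤ ‖z.1‖ ^ k + ‖z.2‖ ^ k := by
    rcases max_cases ‖z.1‖ ‖z.2‖ with h | h <;> rw [Prod.norm_def, h.1]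
    · exact le_add_of_nonneg_right (by positivity)
    · exact le_add_of_nonneg_left (by positivity)
  have a1 := (hA i).2 z.1
  have a2 := (hA' i).2 z.1
  have b1 := (hB (n - i)).2 z.2
  have b2 := (hB' (n - i)).2 z.2
  rw [pow_zero, one_mul] at a2 b2
  set u := ‖iteratedFDeriv ℝ i f z.1‖
  set v := ‖iteratedFDeriv ℝ (n - i) g z.2‖
  have hu : 0 ≤ u := norm_nonneg _
  have hv : 0 ≤ v := norm_nonneg _
  have hx : 0 ≤ ‖z.1‖ ^ k := by positivity
  have hy : 0 ≤ ‖z.2‖ ^ k := by positivity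
  calc _ ≤ (‖z.1‖ ^ k + ‖z.2‖ ^ k) * ((n.choose i : ℝ) * u * v) := by gcongr
    _ = (n.choose i : ℝ) * ((‖z.1‖ ^ k * u) * v + u * (‖z.2‖ ^ k * v)) := by ring
    _ ≤ _ := by
      gcongr
      · exact (mul_nonneg hx hu).trans a1
      · exact hu.trans a2

/-- The tensor product `(x, y) ↦ f x * g y`. -/
def tensor {d : ℕ} (f g : 𝓢(Pos d, ℂ)) : 𝓢(Phase d, ℂ) where
  toFun z := f z.1 * g z.2
  smooth' := ((f.smooth ⊤).comp contDiff_fst).mul ((g.smooth ⊤).comp contDiff_snd)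
  decay' := tensor_decay f g


/-- Complex conjugation of a Schwartz function. -/
def conjS {E : Type} [NormedAddCommGroup E] [NormedSpace ℝ E] (f : 𝓢(E, ℂ)) : 𝓢(E, ℂ) :=
  postcompCLM (𝕜 := ℝ) (Complex.conjCLE : ℂ →L[ℝ] ℂ) f

/-- The linear change of variables `(x, t) ↦ (x + t / 2, x - t / 2)`. -/
def midpointMap (d : ℕ) : Phase d ≃L[ℝ] Phase d :=
  LinearEquiv.toContinuousLinearEquiv
    { toFun := fun z => (z.1 + (2⁻¹ : ℝ) • z.2, z.1 - (2⁻¹ : ℝ) • z.2)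
      invFun := fun z => ((2⁻¹ : ℝ) • (z.1 + z.2), z.1 - z.2)
      map_add' := fun z w => by ext <;> simp <;> ring
      map_smul' := fun c z => by ext <;> simp <;> ring
      left_inv := fun z => by ext <;> simp <;> ring
      right_inv := fun z => by ext <;> simp <;> ring }

/-- The cross-Wigner distribution `W(f, g)`; see `wigner_apply`. -/
def wigner {d : ℕ} (f g : 𝓢(Pos d, ℂ)) : 𝓢(Phase d, ℂ) :=
  partialFourier (compCLMOfContinuousLinearEquiv ℂ (midpointMap d) (tensor f (conjS g)))

theorem wigner_apply {d : ℕ} (f g : 𝓢(Pos d, ℂ)) (z : Phase d) :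
    wigner f g z = ∫ t : Pos d, Complex.exp (-2 * Real.pi * Complex.I * (⟪z.2, t⟫_ℝ : ℝ)) *
      (f (z.1 + (2⁻¹ : ℝ) • t) * conj (g (z.1 - (2⁻¹ : ℝ) • t))) := by
  refine integral_congr_ae (.of_forall fun t => ?_)
  change ((𝐞 (-⟪t, z.2⟫_ℝ) : Circle) : ℂ) • ((_ : ℂ) * _) = _
  rw [Real.fourierChar_apply, real_inner_comm, smul_eq_mul]
  congr 1
  congr 1
  push_cast
  ring

/-- The cross-ambiguity function `A(f, g)`; see `ambiguity_apply` and `ambiguity_eq_stft`. -/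
def ambiguity {d : ℕ} (f g : 𝓢(Pos d, ℂ)) : 𝓢(Phase d, ℂ) :=
  partialFourier (compCLMOfContinuousLinearEquiv ℂ
    ((ContinuousLinearEquiv.prodComm ℝ (Pos d) (Pos d)).trans (midpointMap d))
    (tensor f (conjS g)))

theorem ambiguity_apply {d : ℕ} (f g : 𝓢(Pos d, ℂ)) (z : Phase d) :
    ambiguity f g z = ∫ t : Pos d, Complex.exp (-2 * Real.pi * Complex.I * (⟪z.2, t⟫_ℝ : ℝ)) *
      (f (t + (2⁻¹ : ℝ) • z.1) * conj (g (t - (2⁻¹ : ℝ) • z.1))) := by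
  refine integral_congr_ae (.of_forall fun t => ?_)
  change ((𝐞 (-⟪t, z.2⟫_ℝ) : Circle) : ℂ) • ((_ : ℂ) * _) = _
  rw [Real.fourierChar_apply, real_inner_comm, smul_eq_mul]
  congr 1
  congr 1
  push_cast
  ring

/-- The Hilbert space `L²(ℝᵈ)`. -/
abbrev L2 (d : ℕ) : Type := Lp ℂ 2 (volume : Measure (Pos d))

/-- The translation `T_x f (t) = f (t - x)`. -/
def translation {d : ℕ} (x : Pos d) : L2 d →L[ℂ] L2 d :=
  (Lp.compMeasurePreservingₗᵢ ℂ (fun t : Pos d => t - x)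
    (measurePreserving_sub_right volume x)).toContinuousLinearMap

lemma memLp_character {d : ℕ} (ξ : Pos d) :
    MemLp (fun t : Pos d => Complex.exp (2 * Real.pi * Complex.I * (⟪ξ, t⟫_ℝ : ℝ))) ∞ volume := by
  refine memLp_top_of_bound (Continuous.aestronglyMeasurable (by fun_prop)) 1
    (.of_forall fun t => ?_)
  have e : 2 * Real.pi * Complex.I * (⟪ξ, t⟫_ℝ : ℝ) =
      ((2 * Real.pi * ⟪ξ, t⟫_ℝ : ℝ) : ℂ) * Complex.I := by
    push_cast
    ring
  rw [e, Complex.norm_exp_ofReal_mul_I]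

/-- The modulation `M_ξ f (t) = exp (2 π i ξ · t) f (t)`. -/
def modulation {d : ℕ} (ξ : Pos d) : L2 d →L[ℂ] L2 d :=
  (ContinuousLinearMap.lsmul ℂ ℂ).holderL volume ∞ 2 2 (memLp_character ξ).toLp

/-- The time-frequency shift `π(z) = M_ξ T_x` for `z = (x, ξ)`. -/
def tfShift {d : ℕ} (z : Phase d) : L2 d →L[ℂ] L2 d :=
  modulation z.2 ∘L translation z.1

theorem tfShift_coeFn {d : ℕ} (z : Phase d) (f : L2 d) :
    tfShift z f =ᵐ[volume]
      fun t => Complex.exp (2 * Real.pi * Complex.I * (⟪z.2, t⟫_ℝ : ℝ)) * f (t - z.1) := by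
  have h1 := (ContinuousLinearMap.lsmul ℂ ℂ).coeFn_holder (r := 2)
    (memLp_character z.2).toLp (translation z.1 f)
  have h2 := (memLp_character z.2).coeFn_toLp
  have h3 := Lp.coeFn_compMeasurePreserving f (measurePreserving_sub_right volume z.1)
  filter_upwards [h1, h2, h3] with t h1 h2 h3
  refine h1.trans ?_
  rw [h2]
  exact congrArg (_ * ·) h3

theorem ambiguity_eq_stft {d : ℕ} (f g : 𝓢(Pos d, ℂ)) (z : Phase d) :
    ambiguity f g z = Complex.exp (Real.pi * Complex.I * (⟪z.1, z.2⟫_ℝ : ℝ)) *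
      ⟪tfShift z (g.toLp 2), f.toLp 2⟫_ℂ := by
  rw [L2.inner_def, ambiguity_apply]
  have h : ∫ t : Pos d, ⟪tfShift z (g.toLp 2) t, f.toLp 2 volume t⟫_ℂ =
      ∫ t : Pos d, conj (Complex.exp (2 * Real.pi * Complex.I * (⟪z.2, t⟫_ℝ : ℝ)) *
        g (t - z.1)) * f t := by
    refine integral_congr_ae ?_
    have h3 := (measurePreserving_sub_right volume z.1).quasiMeasurePreserving.ae
      (g.coeFn_toLp 2 volume)
    filter_upwards [tfShift_coeFn z (g.toLp 2), f.coeFn_toLp 2 volume, h3] with t h1 h2 h3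
    rw [h1, h2, h3, RCLike.inner_apply, mul_comm]
  have h' := (integral_add_right_eq_self (μ := volume) (fun t : Pos d =>
    conj (Complex.exp (2 * Real.pi * Complex.I * (⟪z.2, t⟫_ℝ : ℝ)) * g (t - z.1)) * f t)
    ((2⁻¹ : ℝ) • z.1)).symm
  rw [h, h', ← integral_const_mul]
  refine integral_congr_ae (.of_forall fun t => ?_)
  have e : t + (2⁻¹ : ℝ) • z.1 - z.1 = t - (2⁻¹ : ℝ) • z.1 := by
    ext i; simp; ring
  have e' : Complex.exp (-2 * Real.pi * Complex.I * (⟪z.2, t⟫_ℝ : ℝ)) =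
      Complex.exp (Real.pi * Complex.I * (⟪z.1, z.2⟫_ℝ : ℝ)) *
      conj (Complex.exp (2 * Real.pi * Complex.I * (⟪z.2, t + (2⁻¹ : ℝ) • z.1⟫_ℝ : ℝ))) := by
    rw [← Complex.exp_conj, ← Complex.exp_add]
    congr 1
    simp only [map_mul, Complex.conj_ofReal, Complex.conj_I, map_ofNat, inner_add_right,
      inner_smul_right, real_inner_comm z.1 z.2]
    push_cast
    ring
  simp only [e, e', map_mul]
  ring

/-- The parity operator `P f (t) = f (-t)`. -/
def parity (d : ℕ) : L2 d →L[ℂ] L2 d :=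
  (Lp.compMeasurePreservingₗᵢ ℂ (fun t : Pos d => -t)
    (Measure.measurePreserving_neg volume)).toContinuousLinearMap

/-- The operator `Š = P S P`. -/
def opCheck {d : ℕ} (S : L2 d →L[ℂ] L2 d) : L2 d →L[ℂ] L2 d :=
  parity d ∘L S ∘L parity d

/-- The operator modulation `β_w(S) = exp (-π i w₁ · w₂ / 2) π(w / 2) S π(w / 2)`. -/
def opModulation {d : ℕ} (w : Phase d) (S : L2 d →L[ℂ] L2 d) : L2 d →L[ℂ] L2 d :=
  Complex.exp (-(Real.pi * Complex.I * (⟪w.1, w.2⟫_ℝ : ℝ) / 2)) •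
    (tfShift ((2⁻¹ : ℝ) • w) ∘L S ∘L tfShift ((2⁻¹ : ℝ) • w))

/-- `S` is `Λ`-modulation invariant: `S = β_l(S)` for every `l ∈ Λ`. -/
def IsModulationInvariant {d : ℕ} (Λ : Submodule ℤ (Phase d)) (S : L2 d →L[ℂ] L2 d) : Prop :=
  ∀ l ∈ Λ, opModulation l S = S

/-- The symplectic form `Ω((x, ξ), (x', ξ')) = x' · ξ - x · ξ'`. -/
def sympl {d : ℕ} (z w : Phase d) : ℝ := ⟪w.1, z.2⟫_ℝ - ⟪z.1, w.2⟫_ℝ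

/-- The adjoint lattice `Λ° = {z | exp (2 π i Ω(z, l)) = 1 for all l ∈ Λ}`. -/
def adjointLattice {d : ℕ} (Λ : Submodule ℤ (Phase d)) : AddSubgroup (Phase d) where
  carrier := {z | ∀ l ∈ Λ, Complex.exp (2 * Real.pi * Complex.I * (sympl z l : ℝ)) = 1}
  zero_mem' := fun l _ => by simp [sympl]
  add_mem' := fun {z w} hz hw l hl => by
    have e : sympl (z + w) l = sympl z l + sympl w l := by
      simp only [sympl, Prod.fst_add, Prod.snd_add, inner_add_left, inner_add_right]; ring
    rw [e, Complex.ofReal_add, mul_add, Complex.exp_add, hz l hl, hw l hl, one_mul]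
  neg_mem' := fun {z} hz l hl => by
    have e : sympl (-z) l = -sympl z l := by
      simp only [sympl, Prod.fst_neg, Prod.snd_neg, inner_neg_left, inner_neg_right]; ring
    rw [e, Complex.ofReal_neg, mul_neg, Complex.exp_neg, hz l hl, inv_one]

/-- The duality bracket `⟨u, φ⟩` between tempered distributions and Schwartz functions,
antilinear in `φ`. -/
def bracket {d : ℕ} (u : 𝓢'(Phase d, ℂ)) (φ : 𝓢(Phase d, ℂ)) : ℂ := u (conjS φ)

/-- `σ` is the Weyl symbol of the bounded operator `S`: `⟨S f, g⟩ = ⟨σ, W(g, f)⟩` for all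
Schwartz functions `f, g`.  (Mathlib's inner product is antilinear in its first argument.) -/
def IsWeylSymbol {d : ℕ} (S : L2 d →L[ℂ] L2 d) (σ : 𝓢'(Phase d, ℂ)) : Prop :=
  ∀ f g : 𝓢(Pos d, ℂ), ⟪g.toLp 2, S (f.toLp 2)⟫_ℂ = bracket σ (wigner g f)

/-- `u` is the Fourier-Wigner transform of the bounded operator `S`.  The transform
`F_W(R)(z) = exp (-π i x · ξ) tr (π(-z) R)` of trace class operators sends the rank one operator
`h ↦ ⟨h, f⟩ g` to the ambiguity function `A(g, f)`; by duality, `F_W(S)` is the tempered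
distribution with `⟨S f, g⟩ = ⟨F_W(S), A(g, f)⟩` for all Schwartz functions `f, g`.  Equivalently,
`S = ∫ F_W(S)(z) exp (-π i x · ξ) π(z) dz` weakly. -/
def IsFourierWigner {d : ℕ} (S : L2 d →L[ℂ] L2 d) (u : 𝓢'(Phase d, ℂ)) : Prop :=
  ∀ f g : 𝓢(Pos d, ℂ), ⟪g.toLp 2, S (f.toLp 2)⟫_ℂ = bracket u (ambiguity g f)

/-- `u = ∑ i, a i • δ_{p i}`, with unconditional (hence absolute) weak-* convergence. -/
def IsDiracSeries {d : ℕ} {ι : Type} (p : ι → Phase d) (a : ι → ℂ) (u : 𝓢'(Phase d, ℂ)) : Prop :=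
  ∀ φ : 𝓢(Phase d, ℂ), HasSum (fun i => a i * φ (p i)) (u φ)

/-- `u` is the convolution of the discrete measures `∑ a_l δ_l` and `∑ b_m δ_m` on `L`:
`u(φ) = ∑_{l, m} a_l b_m φ(l + m)`, the double series converging absolutely. -/
def IsDiracConvolution {d : ℕ} (L : AddSubgroup (Phase d)) (a b : L → ℂ)
    (u : 𝓢'(Phase d, ℂ)) : Prop :=
  IsDiracSeries (fun p : L × L => (p.1 : Phase d) + (p.2 : Phase d)) (fun p => a p.1 * b p.2) u

/-- The tempered distribution `u` is given by integration against the function `a`. -/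
def IsGivenBy {d : ℕ} (u : 𝓢'(Phase d, ℂ)) (a : Phase d → ℂ) : Prop :=
  ∀ φ : 𝓢(Phase d, ℂ), Integrable (fun z => a z * φ z) ∧ u φ = ∫ z, a z * φ z

/-- The Schwartz function `z ↦ φ (z / 2)`. -/
def halve {d : ℕ} (φ : 𝓢(Phase d, ℂ)) : 𝓢(Phase d, ℂ) :=
  compCLMOfContinuousLinearEquiv ℂ
    (ContinuousLinearEquiv.smulLeft (Units.mk0 (2⁻¹ : ℝ) (by norm_num))) φ

theorem halve_apply {d : ℕ} (φ : 𝓢(Phase d, ℂ)) (z : Phase d) :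
    halve φ z = φ ((2⁻¹ : ℝ) • z) := rfl

end ModInv

end

noncomputable section

namespace ModInv

variable {d : ℕ}

/-! ### Symmetric time-frequency shifts -/

/-! Write ρ(z) for the symmetric shift exp(-πi x·ξ) π(z). Then ρ(z)ρ(w) = exp(πiΩ(z,w)) ρ(z+w) and
Pρ(z)P = ρ(-z). Modulation invariance becomes S = ρ(λ/2) S ρ(λ/2), so that R = SP commutes with
every ρ(λ/2). Hence z ↦ ρ(-z/2) R ρ(z/2) is Λ-periodic and lives on the torus ℝ²ᵈ/Λ, whose
characters are exp(2πiΩ(m,·)) with m ∈ Λ°. Its m-th Fourier coefficient transforms under conjugation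
by shifts exactly as ρ(2m) does, so by Schur's lemma it equals r_m ρ(2m) (`exists_coeffOp_eq`).
Bessel's inequality for this vector-valued function gives r ∈ ℓ², and its Fourier series at 0 is the
weak expansion SP = ∑ r_m ρ(2m) (`exists_hasExpansion`).

The theorem is read off from these expansions. Since W(g,f)(z) = 2^d A(g,Pf)(2z), the symbol of S is
∑ 2^(-d) r_m δ_m. If TP = ∑ t_m ρ(2m), then P(TP)P has coefficients t_{-m}, and ST = (SP)(P(TP)P) is
the sum of r_l t_{-m} ρ(2l)ρ(2m). The cocycle here is exp(4πiΩ(l,m)), which is 1 because 2Ω is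
integral on Λ°. So the ρ(2m) form a commutative group, the coefficients of a product are convolved,
and SP, TP commute, which is SŤ = TŠ. As ρ(2γ) has Fourier-Wigner transform δ_{2γ}, this is the
formula for F_W(ST); the factor 2^(2d) undoes the two normalizations 2^(-d).

For the last formula, F_W is the symplectic Fourier transform of the Weyl symbol, so F_W(S) is the
periodic function in L² of the torus with Fourier coefficients c_m, and the convolution turns into a
product of two such functions.

The analytic input is that matrix coefficients of ρ between Schwartz functions are ambiguity
functions, hence absolutely summable on Λ°; with only one Schwartz vector they are still square
summable (`summable_inner_of_gram_le`). Double series pairing two ℓ² sequences with an ℓ¹ sequence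
at l + m converge absolutely (`summable_mul_mul_add`), which justifies all rearrangements. -/

lemma norm_exp_I_mul (x : ℝ) : ‖Complex.exp (Real.pi * Complex.I * x)‖ = 1 := by
  have e : (Real.pi * Complex.I * x : ℂ) = ((Real.pi * x : ℝ) : ℂ) * Complex.I := by
    push_cast; ring
  rw [e, Complex.norm_exp_ofReal_mul_I]

/-- The symmetric time-frequency shift `ρ(x, ξ) = exp (-π i x · ξ) π(x, ξ)`. -/
def rho (z : Phase d) : L2 d →L[ℂ] L2 d :=
  Complex.exp (-(Real.pi * Complex.I * (⟪z.1, z.2⟫_ℝ : ℝ))) • tfShift z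

lemma rho_coeFn (z : Phase d) (f : L2 d) :
    rho z f =ᵐ[volume] fun t =>
      Complex.exp (2 * Real.pi * Complex.I * (⟪z.2, t⟫_ℝ : ℝ)
        - Real.pi * Complex.I * (⟪z.1, z.2⟫_ℝ : ℝ)) * f (t - z.1) := by
  have h := Lp.coeFn_smul (Complex.exp (-(Real.pi * Complex.I * (⟪z.1, z.2⟫_ℝ : ℝ)))) (tfShift z f)
  filter_upwards [h, tfShift_coeFn z f] with t h1 h2
  rw [rho, smul_apply, h1, Pi.smul_apply, h2, smul_eq_mul, ← mul_assoc,
    ← Complex.exp_add]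
  congr 2
  ring

lemma rho_rho (z w : Phase d) (f : L2 d) :
    rho z (rho w f) = Complex.exp (Real.pi * Complex.I * (sympl z w : ℝ)) • rho (z + w) f := by
  apply Lp.ext
  have h3 := (measurePreserving_sub_right volume z.1).quasiMeasurePreserving.ae (rho_coeFn w f)
  filter_upwards [rho_coeFn z (rho w f), h3, rho_coeFn (z + w) f, Lp.coeFn_smul
    (Complex.exp (Real.pi * Complex.I * (sympl z w : ℝ))) (rho (z + w) f)] with t h1 h2 h4 h5
  rw [h1, h2, h5, Pi.smul_apply, h4, smul_eq_mul, ← mul_assoc, ← mul_assoc, ← Complex.exp_add,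
    ← Complex.exp_add]
  have e : t - z.1 - w.1 = t - (z + w).1 := by simp [sub_sub]
  rw [e]
  congr 2
  simp only [sympl, Prod.fst_add, Prod.snd_add, inner_add_left, inner_add_right, inner_sub_right,
    real_inner_comm z.1 w.2]
  push_cast
  ring

lemma rho_zero (f : L2 d) : rho 0 f = f := by
  apply Lp.ext
  filter_upwards [rho_coeFn 0 f] with t h1
  rw [h1]
  simp

lemma sympl_self (z : Phase d) : sympl z z = 0 := by
  simp [sympl]

lemma sympl_add_left (z w u : Phase d) : sympl (z + w) u = sympl z u + sympl w u := by
  simp only [sympl, Prod.fst_add, Prod.snd_add, inner_add_left, inner_add_right]; ring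

lemma sympl_add_right (z w u : Phase d) : sympl u (z + w) = sympl u z + sympl u w := by
  simp only [sympl, Prod.fst_add, Prod.snd_add, inner_add_left, inner_add_right]; ring

lemma sympl_smul_left (c : ℝ) (z w : Phase d) : sympl (c • z) w = c * sympl z w := by
  simp only [sympl, Prod.smul_fst, Prod.smul_snd, inner_smul_left, inner_smul_right]; simp; ring

lemma sympl_smul_right (c : ℝ) (z w : Phase d) : sympl z (c • w) = c * sympl z w := by
  simp only [sympl, Prod.smul_fst, Prod.smul_snd, inner_smul_left, inner_smul_right]; simp; ring

lemma sympl_neg_left (z w : Phase d) : sympl (-z) w = -sympl z w := by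
  simpa using sympl_smul_left (-1) z w

lemma sympl_neg_right (z w : Phase d) : sympl z (-w) = -sympl z w := by
  simpa using sympl_smul_right (-1) z w

lemma sympl_comm (z w : Phase d) : sympl z w = -sympl w z := by
  rw [sympl, sympl]; ring

lemma rho_neg_rho (z : Phase d) (f : L2 d) : rho (-z) (rho z f) = f := by
  rw [rho_rho, sympl_neg_left, sympl_self, neg_add_cancel, rho_zero]; simp

lemma rho_rho_neg (z : Phase d) (f : L2 d) : rho z (rho (-z) f) = f := by
  simpa using rho_neg_rho (-z) f

lemma rho_comm (z w : Phase d) (f : L2 d) :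
    rho z (rho w f) = Complex.exp (2 * Real.pi * Complex.I * (sympl z w : ℝ)) •
      rho w (rho z f) := by
  rw [rho_rho, rho_rho, smul_smul, ← Complex.exp_add, add_comm w z, sympl_comm w z]
  congr 2
  push_cast; ring

lemma norm_rho_le (z : Phase d) (f : L2 d) : ‖rho z f‖ ≤ ‖f‖ := by
  have h : ‖rho z f‖ ≤ ‖translation z.1 f‖ := by
    apply Lp.norm_le_norm_of_ae_le
    have h3 := Lp.coeFn_compMeasurePreserving f (measurePreserving_sub_right volume z.1)
    filter_upwards [rho_coeFn z f, h3] with t h1 h2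
    have e : translation z.1 f t = f (t - z.1) := h2
    rw [h1, e, norm_mul]
    have e : (2 * Real.pi * Complex.I * (⟪z.2, t⟫_ℝ : ℝ)
        - Real.pi * Complex.I * (⟪z.1, z.2⟫_ℝ : ℝ) : ℂ) =
        Real.pi * Complex.I * ((2 * ⟪z.2, t⟫_ℝ - ⟪z.1, z.2⟫_ℝ : ℝ) : ℂ) := by push_cast; ring
    rw [e, norm_exp_I_mul, one_mul]
  refine h.trans (le_of_eq ?_)
  exact (Lp.compMeasurePreservingₗᵢ ℂ _ _).norm_map f

lemma norm_rho (z : Phase d) (f : L2 d) : ‖rho z f‖ = ‖f‖ := by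
  refine le_antisymm (norm_rho_le z f) ?_
  conv_lhs => rw [← rho_neg_rho z f]
  exact norm_rho_le _ _

lemma inner_rho_rho (z : Phase d) (f g : L2 d) : ⟪rho z f, rho z g⟫_ℂ = ⟪f, g⟫_ℂ :=
  LinearIsometry.inner_map_map ⟨(rho z : L2 d →ₗ[ℂ] L2 d), norm_rho z⟩ f g

lemma inner_rho_left (z : Phase d) (f g : L2 d) : ⟪rho z f, g⟫_ℂ = ⟪f, rho (-z) g⟫_ℂ := by
  rw [← inner_rho_rho (-z), rho_neg_rho]

lemma inner_rho_right (z : Phase d) (f g : L2 d) : ⟪f, rho z g⟫_ℂ = ⟪rho (-z) f, g⟫_ℂ := by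
  rw [← inner_rho_rho (-z), rho_neg_rho]

lemma ambiguity_eq_inner (g f : 𝓢(Pos d, ℂ)) (z : Phase d) :
    ambiguity g f z = ⟪rho z (f.toLp 2), g.toLp 2⟫_ℂ := by
  rw [ambiguity_eq_stft, rho, smul_apply, inner_smul_left, ← Complex.exp_conj]
  simp

lemma conj_ambiguity (g f : 𝓢(Pos d, ℂ)) (z : Phase d) :
    conj (ambiguity g f z) = ⟪g.toLp 2, rho z (f.toLp 2)⟫_ℂ := by
  rw [ambiguity_eq_inner, inner_conj_symm]

/-! ### The parity operator -/

lemma parity_coeFn (f : L2 d) : parity d f =ᵐ[volume] fun t => f (-t) :=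
  Lp.coeFn_compMeasurePreserving f (Measure.measurePreserving_neg volume)

lemma parity_parity (f : L2 d) : parity d (parity d f) = f := by
  apply Lp.ext
  filter_upwards [parity_coeFn (parity d f), (Measure.measurePreserving_neg
    volume).quasiMeasurePreserving.ae (parity_coeFn f)] with t h1 h2
  rw [h1, h2, neg_neg]

lemma inner_parity_parity (f g : L2 d) : ⟪parity d f, parity d g⟫_ℂ = ⟪f, g⟫_ℂ :=
  (Lp.compMeasurePreservingₗᵢ ℂ (fun t : Pos d => -t)
    (Measure.measurePreserving_neg volume)).inner_map_map f g

lemma inner_parity_right (f g : L2 d) : ⟪f, parity d g⟫_ℂ = ⟪parity d f, g⟫_ℂ := by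
  rw [← inner_parity_parity, parity_parity]

lemma parity_rho (z : Phase d) (f : L2 d) : parity d (rho z f) = rho (-z) (parity d f) := by
  apply Lp.ext
  filter_upwards [parity_coeFn (rho z f), (Measure.measurePreserving_neg
    volume).quasiMeasurePreserving.ae (rho_coeFn z f), rho_coeFn (-z) (parity d f),
    (measurePreserving_sub_right volume (-z).1).quasiMeasurePreserving.ae (parity_coeFn f)]
    with t h1 h2 h3 h4
  rw [h1, h2, h3, h4]
  congr 2
  · simp
  · simp; abel

/-- The reflection `t ↦ f (-t)` of a Schwartz function. -/
def reflectS (f : 𝓢(Pos d, ℂ)) : 𝓢(Pos d, ℂ) :=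
  compCLMOfContinuousLinearEquiv ℂ (ContinuousLinearEquiv.neg ℝ) f

lemma reflectS_apply (f : 𝓢(Pos d, ℂ)) (t : Pos d) : reflectS f t = f (-t) := rfl

lemma toLp_reflectS (f : 𝓢(Pos d, ℂ)) : (reflectS f).toLp 2 = parity d (f.toLp 2) := by
  apply Lp.ext
  filter_upwards [parity_coeFn (f.toLp 2), (Measure.measurePreserving_neg
    volume).quasiMeasurePreserving.ae (f.coeFn_toLp 2 volume),
    (reflectS f).coeFn_toLp 2 volume] with t h1 h2 h3
  rw [h1, h2, h3, reflectS_apply]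

/-! ### The Wigner distribution as a dilated ambiguity function. -/

/-- The substitution t ↦ 2t in the Wigner integral produces the factor 2^d and doubles the phase
space point. This is why symbols supported on Λ° correspond to shifts by 2Λ°. -/
lemma wigner_eq_ambiguity (g f : 𝓢(Pos d, ℂ)) (z : Phase d) :
    wigner g f z = 2 ^ d * ambiguity g (reflectS f) ((2 : ℝ) • z) := by
  rw [wigner_apply, ambiguity_apply]
  have h := Measure.integral_comp_smul (μ := (volume : Measure (Pos d)))
    (fun t : Pos d => Complex.exp (-2 * Real.pi * Complex.I * (⟪z.2, t⟫_ℝ : ℝ)) *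
      (g (z.1 + (2⁻¹ : ℝ) • t) * conj (f (z.1 - (2⁻¹ : ℝ) • t)))) 2
  rw [finrank_euclideanSpace_fin, abs_of_nonneg (by positivity), Complex.real_smul] at h
  have h' : ∀ I J : ℂ, J = ((2 ^ d : ℝ)⁻¹ : ℝ) * I → I = 2 ^ d * J := by
    rintro I J rfl
    push_cast
    field_simp
  refine h' _ _ (Eq.trans ?_ h)
  refine integral_congr_ae (.of_forall fun t => ?_)
  have e1 : t + (2⁻¹ : ℝ) • ((2 : ℝ) • z).1 = z.1 + (2⁻¹ : ℝ) • (2 : ℝ) • t := by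
    simp [smul_smul, add_comm]
  have e2 : -(t - (2⁻¹ : ℝ) • ((2 : ℝ) • z).1) = z.1 - (2⁻¹ : ℝ) • (2 : ℝ) • t := by
    simp [smul_smul]
  simp only [reflectS_apply, e1, e2, Prod.smul_snd, inner_smul_left, inner_smul_right]
  simp

lemma conj_wigner (g f : 𝓢(Pos d, ℂ)) (z : Phase d) :
    conj (wigner g f z) = 2 ^ d * ⟪g.toLp 2, rho ((2 : ℝ) • z) (parity d (f.toLp 2))⟫_ℂ := by
  rw [wigner_eq_ambiguity, map_mul, conj_ambiguity, toLp_reflectS, map_pow, map_ofNat]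

lemma denseRange_toLp : DenseRange (fun f : 𝓢(Pos d, ℂ) => f.toLp 2 (volume : Measure (Pos d))) :=
  denseRange_toLpCLM (F := ℂ) (μ := (volume : Measure (Pos d))) (p := 2) (by simp)

/-! ### Strong continuity -/

lemma continuous_inner_rho (f : 𝓢(Pos d, ℂ)) :
    Continuous fun z => ⟪rho z (f.toLp 2), f.toLp 2⟫_ℂ := by
  simp_rw [← ambiguity_eq_inner]
  exact (ambiguity f f).continuous

/-- The squared distance from ρ(z)F to ρ(w)F is 2‖F‖² minus twice the real part of a continuous
phase times A(f,f)(z - w), and the ambiguity function is continuous. -/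
lemma continuous_rho_toLp (f : 𝓢(Pos d, ℂ)) : Continuous fun z => rho z (f.toLp 2) := by
  rw [continuous_iff_continuousAt]
  intro w
  set F := f.toLp 2 (volume : Measure (Pos d))
  have h : ∀ z, ‖rho z F - rho w F‖ ^ 2 = 2 * ‖F‖ ^ 2 -
      2 * (Complex.exp (-(Real.pi * Complex.I * (sympl (-w) z : ℝ))) *
        ⟪rho (-w + z) F, F⟫_ℂ).re := fun z => by
    rw [@norm_sub_sq ℂ, norm_rho, norm_rho]
    have e : ⟪rho z F, rho w F⟫_ℂ = Complex.exp (-(Real.pi * Complex.I * (sympl (-w) z : ℝ))) *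
        ⟪rho (-w + z) F, F⟫_ℂ := by
      rw [inner_rho_right, rho_rho, inner_smul_left, ← Complex.exp_conj]
      simp
    rw [e]
    simp; ring
  rw [ContinuousAt, tendsto_iff_norm_sub_tendsto_zero]
  have hc : Continuous fun z => ‖rho z F - rho w F‖ ^ 2 := by
    simp_rw [h]
    have h1 : Continuous fun z : Phase d => ⟪rho (-w + z) F, F⟫_ℂ :=
      (continuous_inner_rho f).comp (by fun_prop)
    have h2 : Continuous fun z : Phase d => sympl (-w) z := by
      unfold sympl; fun_prop
    fun_prop
  have := hc.sqrt.tendsto w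
  simpa [Real.sqrt_sq_eq_abs] using this

/-- Each ρ(z) is isometric, so convergence in L² gives convergence of the orbit maps uniformly in z,
and continuity passes from the dense Schwartz vectors to all vectors. -/
lemma continuous_rho (f : L2 d) : Continuous fun z => rho z f := by
  refine denseRange_toLp.induction_on (p := fun f => Continuous fun z => rho z f) f ?_
    continuous_rho_toLp
  rw [← isSeqClosed_iff_isClosed]
  intro u f hu huf
  refine TendstoUniformly.continuous (F := fun n z => rho z (u n)) (p := Filter.atTop) ?_
    (Filter.Frequently.of_forall hu)
  rw [Metric.tendstoUniformly_iff]
  intro ε hε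
  filter_upwards [Metric.tendsto_atTop.1 huf |> fun h => Filter.eventually_atTop.2 (h ε hε)]
    with n hn z
  rw [dist_eq_norm, ← map_sub, norm_rho, ← dist_eq_norm, dist_comm]
  exact hn

end ModInv

end

noncomputable section

namespace ModInv

variable {d : ℕ}

instance : (volume : Measure (Phase d)).IsAddHaarMeasure :=
  inferInstanceAs ((volume : Measure (Pos d)).prod volume).IsAddHaarMeasure

/-! ### Partial Fourier transforms, Moyal's identity and the symplectic Fourier transform -/

/-- The slice `t ↦ H (x, t)` of a Schwartz function. -/
def slice (H : 𝓢(Phase d, ℂ)) (x : Pos d) : 𝓢(Pos d, ℂ) :=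
  compCLMOfAntilipschitz ℂ (K := 1) (g := fun t : Pos d => ((x, t) : Phase d))
    (by
      have e : (fun t : Pos d => ((x, t) : Phase d)) =
          fun t => (x, (0 : Pos d)) + ContinuousLinearMap.inr ℝ (Pos d) (Pos d) t := by
        ext t <;> simp
      rw [e]
      fun_prop)
    (AntilipschitzWith.of_le_mul_dist fun s t => by simp [Prod.dist_eq]) H

lemma slice_apply (H : 𝓢(Phase d, ℂ)) (x t : Pos d) : slice H x t = H (x, t) := rfl

lemma fourier_slice (H : 𝓢(Phase d, ℂ)) (x ξ : Pos d) :
    𝓕 (slice H x) ξ = partialFourier H (x, ξ) := rfl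

lemma integral_slice_inversion (H : 𝓢(Phase d, ℂ)) (x s : Pos d) :
    ∫ ξ, Complex.exp (2 * Real.pi * Complex.I * (⟪ξ, s⟫_ℝ : ℝ)) * partialFourier H (x, ξ) =
      H (x, s) := by
  have h : 𝓕⁻ (𝓕 (slice H x)) s = slice H x s := by
    rw [FourierTransform.fourierInv_fourier_eq]
  rw [slice_apply] at h
  rw [← h, fourierInv_coe, Real.fourierInv_eq]
  refine integral_congr_ae (.of_forall fun ξ => ?_)
  simp only [fourier_slice, Circle.smul_def, Real.fourierChar_apply, smul_eq_mul]
  congr 2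
  push_cast; ring

lemma norm_exp_two_pi (x : ℝ) : ‖Complex.exp (2 * Real.pi * Complex.I * x)‖ = 1 := by
  have := norm_exp_I_mul (2 * x)
  rw [← this]; congr 2; push_cast; ring

lemma norm_exp_neg_two_pi (x : ℝ) : ‖Complex.exp (-(2 * Real.pi * Complex.I * x))‖ = 1 := by
  have := norm_exp_two_pi (-x)
  rw [← this]; congr 2; push_cast; ring

lemma continuous_sympl_right (z : Phase d) : Continuous (sympl z) := by
  unfold sympl; fun_prop

lemma integrable_mul_exp (φ : 𝓢(Phase d, ℂ)) (z : Phase d) :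
    Integrable fun w => φ w * Complex.exp (-(2 * Real.pi * Complex.I * (sympl z w : ℝ))) := by
  have := continuous_sympl_right z
  refine (φ.integrable (μ := volume)).norm.mono' (Continuous.aestronglyMeasurable (by fun_prop))
    (.of_forall fun w => ?_)
  rw [norm_mul, norm_exp_neg_two_pi, mul_one]

/-- Integrating over frequency inverts the partial transform of H; the remaining integral over
position is the partial transform of K. The Wigner and ambiguity functions arise from one function
with its variables exchanged, so the symplectic Fourier transform swaps them. -/
lemma sympl_fourier_partialFourier (H K : 𝓢(Phase d, ℂ)) (hK : ∀ x t, K (x, t) = H (t, x))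
    (z : Phase d) :
    ∫ w, partialFourier H w * Complex.exp (-(2 * Real.pi * Complex.I * (sympl z w : ℝ))) =
      partialFourier K z := by
  have hi := integrable_mul_exp (partialFourier H) z
  rw [Measure.volume_eq_prod] at hi ⊢
  rw [integral_prod _ hi]
  change _ = ∫ t : Pos d, 𝐞 (-⟪t, z.2⟫_ℝ) • K (z.1, t)
  refine integral_congr_ae (.of_forall fun t => ?_)
  simp only [hK]
  rw [← integral_slice_inversion H t z.1, Circle.smul_def, smul_eq_mul, ← integral_const_mul]
  refine integral_congr_ae (.of_forall fun ξ => ?_)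
  simp only
  rw [mul_comm, ← mul_assoc, Real.fourierChar_apply, ← Complex.exp_add]
  congr 2
  simp only [sympl, real_inner_comm z.1 ξ]
  push_cast; ring

lemma sympl_fourier_wigner (f g : 𝓢(Pos d, ℂ)) (z : Phase d) :
    ∫ w, wigner f g w * Complex.exp (-(2 * Real.pi * Complex.I * (sympl z w : ℝ))) =
      ambiguity f g z :=
  sympl_fourier_partialFourier _ _ (fun _ _ => rfl) z

lemma sympl_fourier_ambiguity (f g : 𝓢(Pos d, ℂ)) (z : Phase d) :
    ∫ w, ambiguity f g w * Complex.exp (-(2 * Real.pi * Complex.I * (sympl z w : ℝ))) =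
      wigner f g z :=
  sympl_fourier_partialFourier _ _ (fun _ _ => rfl) z

lemma integrable_mul_conj (φ ψ : 𝓢(Phase d, ℂ)) : Integrable fun z => φ z * conj (ψ z) := by
  refine ((φ.integrable (μ := volume)).mul_bdd (c := SchwartzMap.seminorm ℝ 0 0 ψ)
    (g := fun z => conj (ψ z)) (Continuous.aestronglyMeasurable (by fun_prop)) (.of_forall fun z => ?_))
  rw [RCLike.norm_conj]
  exact norm_le_seminorm ℝ ψ z

/-- Plancherel in the second variable, slice by slice. -/
lemma integral_partialFourier_mul_conj (H K : 𝓢(Phase d, ℂ)) :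
    ∫ z, partialFourier H z * conj (partialFourier K z) = ∫ z, H z * conj (K z) := by
  have h1 := integrable_mul_conj (partialFourier H) (partialFourier K)
  have h2 := integrable_mul_conj H K
  rw [Measure.volume_eq_prod] at h1 h2 ⊢
  rw [integral_prod _ h1, integral_prod _ h2]
  refine integral_congr_ae (.of_forall fun x => ?_)
  have h := integral_inner_fourier_fourier (slice K x) (slice H x)
  simpa only [RCLike.inner_apply, fourier_slice, slice_apply] using h

lemma measurePreserving_midpoint_swap :
    MeasurePreserving ((ContinuousLinearEquiv.prodComm ℝ (Pos d) (Pos d)).trans (midpointMap d)) := by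
  have h1 : MeasurePreserving (fun p : Phase d => (p.1, p.2 - (2⁻¹ : ℝ) • p.1)) :=
    MeasurePreserving.skew_product (g := fun (a : Pos d) (c : Pos d) => c - (2⁻¹ : ℝ) • a)
      (.id volume) (Continuous.measurable (by fun_prop))
      (.of_forall fun a => (measurePreserving_sub_right volume _).map_eq)
  have h2 : MeasurePreserving (fun p : Phase d => (p.1, p.2 + p.1)) :=
    MeasurePreserving.skew_product (g := fun (a : Pos d) (c : Pos d) => c + a)
      (.id volume) (Continuous.measurable (by fun_prop))
      (.of_forall fun a => (measurePreserving_add_right volume _).map_eq)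
  have h3 : MeasurePreserving (Prod.swap : Phase d → Phase d) := Measure.measurePreserving_swap
  -- The map (x, t) ↦ (t + x/2, t - x/2) factors into two shears, each followed by a swap.
  have h := (h3.comp h2).comp (h3.comp h1)
  convert! h using 1
  ext p i
  · simp [midpointMap]; ring
  · simp [midpointMap]

lemma integral_tensor_mul_conj (f g h k : 𝓢(Pos d, ℂ)) :
    ∫ z, tensor g (conjS f) z * conj (tensor k (conjS h) z) =
      ⟪k.toLp 2, g.toLp 2⟫_ℂ * ⟪f.toLp 2, h.toLp 2⟫_ℂ := by
  rw [inner_toL2_toL2_eq k g volume, inner_toL2_toL2_eq f h volume, ← integral_prod_mul, Measure.volume_eq_prod]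
  refine integral_congr_ae (.of_forall fun z => ?_)
  change g z.1 * conj (f z.2) * conj (k z.1 * conj (h z.2)) = _
  simp only [map_mul, RCLike.inner_apply, Complex.conj_conj]
  ring

/-- **Moyal's identity** for the cross-ambiguity function. -/
lemma integral_ambiguity_mul_conj (f g h k : 𝓢(Pos d, ℂ)) :
    ∫ z, ambiguity g f z * conj (ambiguity k h z) =
      ⟪k.toLp 2, g.toLp 2⟫_ℂ * ⟪f.toLp 2, h.toLp 2⟫_ℂ := by
  rw [← integral_tensor_mul_conj]
  refine (integral_partialFourier_mul_conj _ _).trans ?_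
  exact measurePreserving_midpoint_swap.integral_comp
    ((ContinuousLinearEquiv.prodComm ℝ (Pos d) (Pos d)).trans
      (midpointMap d)).toHomeomorph.measurableEmbedding
    (fun z => tensor g (conjS f) z * conj (tensor k (conjS h) z))

/-! ### Irreducibility of the Schrödinger representation -/

lemma integrable_smul_rho (φ : 𝓢(Phase d, ℂ)) (h : L2 d) :
    Integrable fun z => φ z • rho z h := by
  have := continuous_rho h
  refine ((φ.integrable (μ := volume)).norm.mul_const ‖h‖).mono'
    (Continuous.aestronglyMeasurable (by fun_prop)) (.of_forall fun z => ?_)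
  rw [norm_smul, norm_rho]

/-- The integrated representation `φ ↦ ∫ φ(z) ρ(z) dz`. -/
def integratedRho (φ : 𝓢(Phase d, ℂ)) : L2 d →L[ℂ] L2 d :=
  LinearMap.mkContinuous
    { toFun := fun h => ∫ z, φ z • rho z h
      map_add' := fun h k => by
        simp only [map_add, smul_add]
        exact integral_add (integrable_smul_rho φ h) (integrable_smul_rho φ k)
      map_smul' := fun c h => by
        simp only [map_smul, RingHom.id_apply]
        rw [← integral_smul]
        simp only [smul_comm c] }
    (∫ z, ‖φ z‖) fun h => by
      refine (norm_integral_le_integral_norm _).trans (le_of_eq ?_)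
      simp only [norm_smul, norm_rho]
      rw [integral_mul_const]

lemma integratedRho_apply (φ : 𝓢(Phase d, ℂ)) (h : L2 d) :
    integratedRho φ h = ∫ z, φ z • rho z h := rfl

lemma eq_of_forall_inner_toLp {u v : L2 d} (h : ∀ k : 𝓢(Pos d, ℂ), ⟪k.toLp 2, u⟫_ℂ = ⟪k.toLp 2, v⟫_ℂ) :
    u = v := by
  refine ext_inner_left ℂ fun w => ?_
  refine denseRange_toLp.induction_on (p := fun w => ⟪w, u⟫_ℂ = ⟪w, v⟫_ℂ) w ?_ h
  exact isClosed_eq (by fun_prop) (by fun_prop)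

lemma clm_eq_of_forall_toLp {A B : L2 d →L[ℂ] L2 d}
    (h : ∀ f : 𝓢(Pos d, ℂ), A (f.toLp 2) = B (f.toLp 2)) : A = B := by
  ext1 w
  exact denseRange_toLp.induction_on (p := fun w => A w = B w) w
    (isClosed_eq (by fun_prop) (by fun_prop)) h

lemma clm_eq_of_forall_inner {A B : L2 d →L[ℂ] L2 d}
    (h : ∀ f g : 𝓢(Pos d, ℂ), ⟪g.toLp 2, A (f.toLp 2)⟫_ℂ = ⟪g.toLp 2, B (f.toLp 2)⟫_ℂ) : A = B :=
  clm_eq_of_forall_toLp fun f => eq_of_forall_inner_toLp (h f)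

/-- By Moyal's identity both sides have the same matrix coefficients. Thus the integrated
representation contains all rank one operators built from Schwartz functions. -/
lemma integratedRho_ambiguity (f g : 𝓢(Pos d, ℂ)) (h : L2 d) :
    integratedRho (ambiguity g f) h = ⟪f.toLp 2, h⟫_ℂ • g.toLp 2 volume := by
  have key : integratedRho (ambiguity g f) = (innerSL ℂ (f.toLp 2)).smulRight (g.toLp 2) := by
    refine clm_eq_of_forall_inner fun h k => ?_
    rw [integratedRho_apply, ← integral_inner (integrable_smul_rho _ _)]
    simp only [inner_smul_right, ← conj_ambiguity]
    rw [integral_ambiguity_mul_conj]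
    simp [inner_smul_right, mul_comm]
  rw [key]; simp

/-- **Schur's lemma**: a bounded operator commuting with all time-frequency shifts is scalar. -/
lemma exists_eq_smul_of_commute (B : L2 d →L[ℂ] L2 d) (hB : ∀ z f, B (rho z f) = rho z (B f)) :
    ∃ c : ℂ, ∀ f, B f = c • f := by
  -- Commuting with every ρ(z), B commutes with the integrated representation, hence with the rank
  -- one operator h ↦ ⟪f, h⟫ g. Taking h = f below then forces B to be scalar.
  have key : ∀ (f g : 𝓢(Pos d, ℂ)) (h : L2 d),
      ⟪f.toLp 2, B h⟫_ℂ • g.toLp 2 volume = ⟪f.toLp 2, h⟫_ℂ • B (g.toLp 2 volume) := fun f g h => by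
    rw [← integratedRho_ambiguity, ← map_smul, ← integratedRho_ambiguity, integratedRho_apply,
      integratedRho_apply, ← ContinuousLinearMap.integral_comp_comm B (integrable_smul_rho _ _)]
    simp only [map_smul, hB]
  have ext : ∀ c : ℂ, (∀ f : 𝓢(Pos d, ℂ), B (f.toLp 2) = c • f.toLp 2 volume) → ∀ f, B f = c • f :=
    fun c hc f => by
      have : B = c • ContinuousLinearMap.id ℂ (L2 d) := clm_eq_of_forall_toLp fun f => by simp [hc f]
      rw [this]; simp
  by_cases hf : ∃ f : 𝓢(Pos d, ℂ), f.toLp 2 (volume : Measure (Pos d)) ≠ 0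
  · obtain ⟨f, hf⟩ := hf
    refine ⟨⟪f.toLp 2, B (f.toLp 2)⟫_ℂ / ⟪f.toLp 2, f.toLp 2⟫_ℂ, ext _ fun g => ?_⟩
    have h0 : ⟪f.toLp 2 (volume : Measure (Pos d)), f.toLp 2⟫_ℂ ≠ 0 := inner_self_ne_zero.2 hf
    rw [div_eq_inv_mul, mul_smul, key, smul_smul, inv_mul_cancel₀ h0, one_smul]
  · push Not at hf
    exact ⟨0, ext _ fun f => by simp [hf f]⟩

end ModInv

end

noncomputable section

namespace ModInv

/-! ### Lattices and tori -/

attribute [local instance] instMeasureSpaceUnitAddCircle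

instance : Measure.IsAddHaarMeasure (volume : Measure UnitAddCircle) :=
  inferInstanceAs (Measure.IsAddHaarMeasure AddCircle.haarAddCircle)

instance : IsProbabilityMeasure (volume : Measure UnitAddCircle) :=
  inferInstanceAs (IsProbabilityMeasure AddCircle.haarAddCircle)

variable {d : ℕ} {ι : Type}

/-- The lattice spanned by a basis of phase space. -/
abbrev latticeOf (B : Module.Basis ι ℝ (Phase d)) : Submodule ℤ (Phase d) :=
  Submodule.span ℤ (Set.range B)

/-- The projection of phase space onto the torus, in the coordinates of a basis. -/
def torusProj (B : Module.Basis ι ℝ (Phase d)) (z : Phase d) : UnitAddTorus ι :=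
  fun i => (B.repr z i : UnitAddCircle)

variable (B : Module.Basis ι ℝ (Phase d))

lemma torusProj_add (z w : Phase d) : torusProj B (z + w) = torusProj B z + torusProj B w := by
  ext i; simp [torusProj]

lemma torusProj_eq_iff (z w : Phase d) : torusProj B z = torusProj B w ↔ w - z ∈ latticeOf B := by
  rw [latticeOf, Module.Basis.mem_span_iff_repr_mem, funext_iff]
  refine forall_congr' fun i => ?_
  simp only [torusProj]
  rw [QuotientAddGroup.eq, AddSubgroup.mem_zmultiples_iff]
  simp [neg_add_eq_sub]

variable [Fintype ι]

lemma isOpenQuotientMap_torusProj : IsOpenQuotientMap (torusProj B) := by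
  have h1 : IsOpenQuotientMap (Pi.map fun (_ : ι) (t : ℝ) => (t : UnitAddCircle)) :=
    IsOpenQuotientMap.piMap fun _ => QuotientAddGroup.isOpenQuotientMap_mk
  have h2 : IsOpenQuotientMap B.equivFunL :=
    B.equivFunL.toHomeomorph.isOpenQuotientMap
  exact h1.comp h2

lemma continuous_torusProj : Continuous (torusProj B) := (isOpenQuotientMap_torusProj B).continuous

lemma torusProj_surjective : Function.Surjective (torusProj B) :=
  (isOpenQuotientMap_torusProj B).surjective

/-- A continuous lattice-periodic function descends to the torus. -/
lemma exists_continuous_torus {X : Type} [TopologicalSpace X] (F : Phase d → X) (hF : Continuous F)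
    (hper : ∀ z, ∀ l ∈ latticeOf B, F (z + l) = F z) :
    ∃ G : C(UnitAddTorus ι, X), ∀ z, G (torusProj B z) = F z := by
  have hq : Topology.IsQuotientMap (⟨torusProj B, continuous_torusProj B⟩ : C(Phase d, UnitAddTorus ι)) :=
    (isOpenQuotientMap_torusProj B).isQuotientMap
  have hf : Function.FactorsThrough (⟨F, hF⟩ : C(Phase d, X))
      (⟨torusProj B, continuous_torusProj B⟩ : C(Phase d, UnitAddTorus ι)) := fun z w h => by
    have := hper z _ ((torusProj_eq_iff B z w).1 h)
    change F z = F w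
    rw [← this]; congr 1; abel
  refine ⟨hq.lift ⟨F, hF⟩ hf, fun z => ?_⟩
  exact DFunLike.congr_fun (hq.lift_comp ⟨F, hF⟩ hf) z

/-! ### The adjoint lattice as the character group of the torus. -/

/-- The coordinates `z ↦ (Ω(z, bᵢ))ᵢ`. -/
def symplCoord : Phase d ≃ₗ[ℝ] (ι → ℝ) :=
  LinearEquiv.ofInjectiveOfFinrankEq
    { toFun := fun z i => sympl z (B i)
      map_add' := fun z w => by ext i; simp [sympl_add_left]
      map_smul' := fun c z => by ext i; simp [sympl_smul_left] }
    (by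
      rw [← LinearMap.ker_eq_bot, LinearMap.ker_eq_bot']
      intro z hz
      have h0 : ∀ w, sympl z w = 0 := by
        let L : Phase d →ₗ[ℝ] ℝ :=
          { toFun := sympl z
            map_add' := fun w w' => sympl_add_right w w' z
            map_smul' := fun c w => by simp [sympl_smul_right] }
        have : L = 0 := B.ext fun i => congrFun hz i
        exact fun w => congrArg (· w) this
      -- Nondegeneracy of Ω: pairing (x, ξ) with (ξ, -x) gives ‖ξ‖² + ‖x‖².
      have h1 := h0 (z.2, -z.1)
      simp only [sympl, inner_neg_right, sub_neg_eq_add] at h1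
      have h2 := real_inner_self_nonneg (x := z.1)
      have h3 := real_inner_self_nonneg (x := z.2)
      exact Prod.ext (inner_self_eq_zero (𝕜 := ℝ).1 (by linarith))
        (inner_self_eq_zero (𝕜 := ℝ).1 (by linarith)))
    (by rw [Module.finrank_fintype_fun_eq_card, Module.finrank_eq_card_basis B])

lemma symplCoord_apply (z : Phase d) (i : ι) : symplCoord B z i = sympl z (B i) := rfl

lemma sympl_eq_sum (z w : Phase d) : sympl z w = ∑ i, sympl z (B i) * B.repr w i := by
  let L : Phase d →ₗ[ℝ] ℝ :=
    { toFun := sympl z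
      map_add' := fun w w' => sympl_add_right w w' z
      map_smul' := fun c w => by simp [sympl_smul_right] }
  have h : L (∑ i, B.repr w i • B i) = L w := by rw [B.sum_repr]
  rw [map_sum] at h
  change L w = _
  rw [← h]
  refine Finset.sum_congr rfl fun i _ => ?_
  rw [map_smul, smul_eq_mul, mul_comm]
  rfl

lemma exp_two_pi_eq_one_iff (x : ℝ) :
    Complex.exp (2 * Real.pi * Complex.I * x) = 1 ↔ ∃ n : ℤ, x = n := by
  rw [Complex.exp_eq_one_iff]
  refine exists_congr fun n => ?_
  rw [mul_comm, mul_left_inj' Complex.two_pi_I_ne_zero]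
  norm_cast

lemma mem_adjointLattice_iff (z : Phase d) :
    z ∈ adjointLattice (latticeOf B) ↔ ∀ i, ∃ n : ℤ, sympl z (B i) = n := by
  constructor
  · exact fun h i => (exp_two_pi_eq_one_iff _).1 (h _ (Submodule.subset_span ⟨i, rfl⟩))
  · intro h l hl
    rw [exp_two_pi_eq_one_iff, sympl_eq_sum B]
    rw [latticeOf, Module.Basis.mem_span_iff_repr_mem] at hl
    choose n hn using h
    choose m hm using hl
    refine ⟨∑ i, n i * m i, ?_⟩
    push_cast
    refine Finset.sum_congr rfl fun i _ => ?_
    rw [hn, ← hm]; rfl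

/-- The symplectic dual basis, which spans the adjoint lattice. -/
def dualBasis : Module.Basis ι ℝ (Phase d) := Module.Basis.ofEquivFun (symplCoord B)

lemma mem_latticeOf_dualBasis (z : Phase d) :
    z ∈ latticeOf (dualBasis B) ↔ z ∈ adjointLattice (latticeOf B) := by
  rw [mem_adjointLattice_iff, latticeOf, Module.Basis.mem_span_iff_repr_mem]
  refine forall_congr' fun i => exists_congr fun n => ?_
  have : (dualBasis B).repr z i = sympl z (B i) := by
    rw [dualBasis, Module.Basis.ofEquivFun_repr_apply, symplCoord_apply]
  rw [this, eq_comm]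
  rfl

/-- The coordinates on the adjoint lattice, as a lattice of characters of the torus. -/
def adjointEquiv : adjointLattice (latticeOf B) ≃ (ι → ℤ) where
  toFun z i := ((mem_adjointLattice_iff B _).1 z.2 i).choose
  invFun n := ⟨(symplCoord B).symm fun i => n i, (mem_adjointLattice_iff B _).2 fun i =>
    ⟨n i, by rw [← symplCoord_apply, LinearEquiv.apply_symm_apply]⟩⟩
  left_inv z := by
    ext1
    simp only
    rw [LinearEquiv.symm_apply_eq]
    ext i
    exact (((mem_adjointLattice_iff B _).1 z.2 i).choose_spec).symm
  right_inv n := by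
    ext i
    have := ((mem_adjointLattice_iff B ((symplCoord B).symm fun i => n i)).1
      ((mem_adjointLattice_iff B _).2 fun i =>
    ⟨n i, by rw [← symplCoord_apply, LinearEquiv.apply_symm_apply]⟩) i).choose_spec
    exact_mod_cast this.symm.trans
      (by rw [← symplCoord_apply, LinearEquiv.apply_symm_apply] :
        sympl ((symplCoord B).symm fun i => (n i : ℝ)) (B i) = n i)

lemma adjointEquiv_spec (m : adjointLattice (latticeOf B)) (i : ι) :
    (adjointEquiv B m i : ℝ) = sympl m (B i) :=
  (((mem_adjointLattice_iff B _).1 m.2 i).choose_spec).symm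

lemma mFourier_torusProj (m : adjointLattice (latticeOf B)) (z : Phase d) :
    UnitAddTorus.mFourier (adjointEquiv B m) (torusProj B z) =
      Complex.exp (2 * Real.pi * Complex.I * (sympl m z : ℝ)) := by
  rw [sympl_eq_sum B]
  simp only [UnitAddTorus.mFourier, ContinuousMap.coe_mk, torusProj, fourier_coe_apply]
  rw [← Complex.exp_sum]
  congr 1
  push_cast
  rw [Finset.mul_sum]
  refine Finset.sum_congr rfl fun i _ => ?_
  rw [← adjointEquiv_spec]
  push_cast
  simp; ring

lemma adjointEquiv_neg (m : adjointLattice (latticeOf B)) :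
    adjointEquiv B (-m) = -adjointEquiv B m := by
  ext i
  have := adjointEquiv_spec B (-m) i
  rw [AddSubgroup.coe_neg, sympl_neg_left, ← adjointEquiv_spec] at this
  exact_mod_cast this

/-! ### Summability of Schwartz functions over lattices -/

lemma summable_lattice_decay : ∃ k : ℕ, Summable fun l : latticeOf B => (1 + ‖(l : Phase d)‖)⁻¹ ^ k := by
  classical
  refine ⟨Module.finrank ℤ (latticeOf B) + 1, ?_⟩
  have h := ZLattice.summable_norm_pow_inv (L := latticeOf B) (Module.finrank ℤ (latticeOf B) + 1) (by omega)
  refine Summable.of_nonneg_of_le (fun _ => by positivity) (fun l => ?_)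
    -- At l = 0 the inverse norm is 0 by convention while the left side is 1, so the indicator of
    -- the origin is added to the majorant.
    (h.add (summable_of_hasFiniteSupport (f := fun l : latticeOf B => if l = 0 then (1 : ℝ) else 0)
      (Set.Finite.subset (Set.finite_singleton 0) fun l hl => by
        simp only [Function.mem_support, ne_eq, ite_eq_right_iff, not_forall] at hl
        exact hl.1)))
  by_cases hl : l = 0
  · simp [hl]
  · have h0 : 0 < ‖l‖ := norm_pos_iff.2 hl
    simp only [hl, if_false, add_zero]
    have : ‖(l : Phase d)‖ = ‖l‖ := rfl
    rw [this]
    gcongr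
    linarith

/-- The adjoint lattice is itself the lattice of the symplectic dual basis. -/
lemma summable_adjointLattice_decay :
    ∃ k : ℕ, Summable fun l : adjointLattice (latticeOf B) => (1 + ‖(l : Phase d)‖)⁻¹ ^ k := by
  obtain ⟨k, hk⟩ := summable_lattice_decay (dualBasis B)
  refine ⟨k, ?_⟩
  let e : adjointLattice (latticeOf B) ≃ latticeOf (dualBasis B) :=
    Equiv.subtypeEquivRight fun z => (mem_latticeOf_dualBasis B z).symm
  exact e.summable_iff.2 hk

/-- The Schwartz seminorm controlling decay of order `k`. -/
def decaySeminorm (k : ℕ) (φ : 𝓢(Phase d, ℂ)) : ℝ :=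
  2 ^ k * (Finset.Iic (k, 0)).sup (fun m => SchwartzMap.seminorm ℂ m.1 m.2) φ

lemma norm_le_decaySeminorm (k : ℕ) (φ : 𝓢(Phase d, ℂ)) (z : Phase d) :
    ‖φ z‖ ≤ decaySeminorm k φ * (1 + ‖z‖)⁻¹ ^ k := by
  have h := one_add_le_sup_seminorm_apply (𝕜 := ℂ) (m := (k, 0)) (k := k) (n := 0) le_rfl le_rfl φ z
  rw [norm_iteratedFDeriv_zero] at h
  rw [inv_pow, ← div_eq_mul_inv, le_div_iff₀ (by positivity), mul_comm]
  exact h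

lemma summable_adjointLattice (φ : 𝓢(Phase d, ℂ)) :
    Summable fun l : adjointLattice (latticeOf B) => ‖φ l‖ := by
  obtain ⟨k, hk⟩ := summable_adjointLattice_decay B
  exact Summable.of_nonneg_of_le (fun _ => norm_nonneg _)
    (fun l => norm_le_decaySeminorm k φ l) (hk.mul_left _)

/-- The Schwartz function `z ↦ φ (2 z)`. -/
def double (φ : 𝓢(Phase d, ℂ)) : 𝓢(Phase d, ℂ) :=
  compCLMOfContinuousLinearEquiv ℂ
    (ContinuousLinearEquiv.smulLeft (Units.mk0 (2 : ℝ) (by norm_num))) φ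

lemma double_apply (φ : 𝓢(Phase d, ℂ)) (z : Phase d) : double φ z = φ ((2 : ℝ) • z) := rfl

/-! ### Integration of periodic functions against Schwartz functions -/

/-- In the coordinates of the basis the domain is the unit cube, and Lebesgue measure becomes a
multiple of Lebesgue measure by uniqueness of Haar measure; C is that multiple. -/
lemma lintegral_fundamentalDomain (B : Module.Basis ι ℝ (Phase d)) : ∃ C : ℝ≥0∞, C ≠ ⊤ ∧
    ∀ u : UnitAddTorus ι → ℝ≥0∞, Measurable u →
      ∫⁻ z in ZSpan.fundamentalDomain B, u (torusProj B z) = C * ∫⁻ y, u y := by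
  classical
  set e := B.equivFunL.toHomeomorph.toMeasurableEquiv with he
  have hH : (Measure.map e (volume : Measure (Phase d))).IsAddHaarMeasure :=
    B.equivFunL.isAddHaarMeasure_map volume
  set c := Measure.addHaarScalarFactor (Measure.map e (volume : Measure (Phase d)))
    (volume : Measure (ι → ℝ)) with hc
  have hm : Measure.map e (volume : Measure (Phase d)) = c • (volume : Measure (ι → ℝ)) :=
    Measure.isAddLeftInvariant_eq_smul _ _
  refine ⟨c, ENNReal.coe_ne_top, fun u hu => ?_⟩
  have hpre : ZSpan.fundamentalDomain B = e ⁻¹' (Set.univ.pi fun _ => Set.Ico (0 : ℝ) 1) := by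
    ext z
    simp [ZSpan.mem_fundamentalDomain, he]
  have hmU : Measurable fun t : ι → ℝ => u fun i => (t i : UnitAddCircle) :=
    hu.comp (measurable_pi_lambda _ fun i => AddCircle.measurable_mk'.comp (measurable_pi_apply i))
  have h1 := setLIntegral_map (μ := (volume : Measure (Phase d))) (g := e)
    (MeasurableSet.univ_pi fun _ : ι => (measurableSet_Ico : MeasurableSet (Set.Ico (0 : ℝ) 1)))
    hmU e.measurable
  rw [hpre]
  refine h1.symm.trans ?_
  have h2 := UnitAddTorus.lintegral_preimage u (fun _ => (0 : ℝ))
  -- The fundamental domain is closed on the left and the torus integral uses cubes closed on the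
  -- right; they differ by a null set.
  have h3 : (Set.univ.pi fun _ : ι => Set.Ico (0 : ℝ) 1) =ᵐ[volume]
      {x : ι → ℝ | ∀ i, x i ∈ Set.Ioc (0 : ℝ) (0 + 1)} := by
    have a1 := Measure.univ_pi_Ico_ae_eq_Icc (μ := fun _ : ι => (volume : Measure ℝ))
      (f := fun _ => (0 : ℝ)) (g := fun _ => (1 : ℝ))
    have a2 := Measure.univ_pi_Ioc_ae_eq_Icc (μ := fun _ : ι => (volume : Measure ℝ))
      (f := fun _ => (0 : ℝ)) (g := fun _ => (1 : ℝ))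
    have a3 : {x : ι → ℝ | ∀ i, x i ∈ Set.Ioc (0 : ℝ) (0 + 1)} =
        Set.univ.pi fun _ : ι => Set.Ioc (0 : ℝ) 1 := by
      ext x; simp [Set.mem_pi]
    rw [a3]
    exact a1.trans a2.symm
  rw [hm, Measure.restrict_smul, lintegral_smul_measure, h2, Measure.restrict_congr_set h3]
  rfl

/-- Phase space is tiled by translates of a bounded fundamental domain, on each of which u has the
same integral. If the domain lies in the ball of radius |R|, the weight on the translate by l is at
most (1 + |R|)^k (1 + ‖l‖)^(-k), and these sum over the lattice. -/
lemma lintegral_torusProj_mul_le (B : Module.Basis ι ℝ (Phase d)) : ∃ (k : ℕ) (C : ℝ≥0∞), C ≠ ⊤ ∧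
    ∀ u : UnitAddTorus ι → ℝ≥0∞, Measurable u →
      ∫⁻ z, u (torusProj B z) * ENNReal.ofReal ((1 + ‖z‖)⁻¹ ^ k) ≤ C * ∫⁻ y, u y := by
  obtain ⟨k, hk⟩ := summable_lattice_decay B
  obtain ⟨C, hC, hCu⟩ := lintegral_fundamentalDomain B
  obtain ⟨R, hR⟩ := (ZSpan.fundamentalDomain_isBounded B).exists_norm_le
  refine ⟨k, ENNReal.ofReal (∑' l : latticeOf B, (1 + |R|) ^ k * (1 + ‖(l : Phase d)‖)⁻¹ ^ k) * C,
    ENNReal.mul_ne_top ENNReal.ofReal_ne_top hC, fun u hu => ?_⟩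
  have hmeas : Measurable fun z => u (torusProj B z) :=
    hu.comp (continuous_torusProj B).measurable
  have : VAddInvariantMeasure (latticeOf B) (Phase d) volume :=
    ⟨fun l s _ => measure_preimage_add volume (l : Phase d) s⟩
  rw [(ZSpan.isAddFundamentalDomain B volume).lintegral_eq_tsum'',
    ENNReal.ofReal_tsum_of_nonneg (fun _ => by positivity) (hk.mul_left _), mul_assoc, ← hCu u hu,
    ← ENNReal.tsum_mul_right]
  refine ENNReal.tsum_le_tsum fun l => ?_
  rw [← lintegral_const_mul _ hmeas]
  refine setLIntegral_mono' (ZSpan.fundamentalDomain_measurableSet B) fun z hz => ?_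
  have hq : torusProj B (l +ᵥ z) = torusProj B z := by
    symm
    rw [torusProj_eq_iff, Submodule.vadd_def, vadd_eq_add, add_sub_cancel_right]
    exact l.2
  rw [hq, mul_comm]
  gcongr
  rw [← mul_pow]
  have hz' : ‖z‖ ≤ |R| := (hR z hz).trans (le_abs_self R)
  have hl : ‖(l : Phase d)‖ ≤ ‖l +ᵥ z‖ + ‖z‖ := by
    rw [Submodule.vadd_def, vadd_eq_add]
    simpa using norm_sub_le ((l : Phase d) + z) z
  refine pow_le_pow_left₀ (by positivity) ?_ k
  rw [inv_le_iff_one_le_mul₀ (by positivity), mul_right_comm, ← div_eq_mul_inv,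
    le_div_iff₀ (by positivity)]
  nlinarith [norm_nonneg (l +ᵥ z), abs_nonneg R]

lemma lintegral_torusProj_mul_schwartz_le (B : Module.Basis ι ℝ (Phase d)) :
    ∃ (k : ℕ) (C : ℝ≥0∞), C ≠ ⊤ ∧ ∀ (φ : 𝓢(Phase d, ℂ)) (u : UnitAddTorus ι → ℝ≥0∞), Measurable u →
      ∫⁻ z, u (torusProj B z) * ‖φ z‖ₑ ≤ C * ENNReal.ofReal (decaySeminorm k φ) * ∫⁻ y, u y := by
  obtain ⟨k, C, hC, h⟩ := lintegral_torusProj_mul_le B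
  refine ⟨k, C, hC, fun φ u hu => ?_⟩
  have hmeas : Measurable fun z : Phase d => u (torusProj B z) * ENNReal.ofReal ((1 + ‖z‖)⁻¹ ^ k) :=
    (hu.comp (continuous_torusProj B).measurable).mul (by fun_prop)
  calc ∫⁻ z, u (torusProj B z) * ‖φ z‖ₑ
      ≤ ∫⁻ z, ENNReal.ofReal (decaySeminorm k φ) *
          (u (torusProj B z) * ENNReal.ofReal ((1 + ‖z‖)⁻¹ ^ k)) := by
        refine lintegral_mono fun z => ?_
        have h1 : ‖φ z‖ₑ ≤ ENNReal.ofReal (decaySeminorm k φ) * ENNReal.ofReal ((1 + ‖z‖)⁻¹ ^ k) := by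
          rw [← ENNReal.ofReal_mul' (by positivity), ← ofReal_norm]
          exact ENNReal.ofReal_le_ofReal (norm_le_decaySeminorm k φ z)
        calc _ ≤ u (torusProj B z) * (ENNReal.ofReal (decaySeminorm k φ) *
              ENNReal.ofReal ((1 + ‖z‖)⁻¹ ^ k)) := by gcongr
          _ = _ := by ring
    _ = ENNReal.ofReal (decaySeminorm k φ) *
          ∫⁻ z, u (torusProj B z) * ENNReal.ofReal ((1 + ‖z‖)⁻¹ ^ k) := lintegral_const_mul _ hmeas
    _ ≤ ENNReal.ofReal (decaySeminorm k φ) * (C * ∫⁻ y, u y) := by gcongr; exact h u hu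
    _ = _ := by ring

/-- Needed because elements of L² of the torus are only classes. The previous bound, applied to the
indicator of a null set with an everywhere positive weight, shows that the preimage is null. -/
lemma quasiMeasurePreserving_torusProj :
    Measure.QuasiMeasurePreserving (torusProj B) volume volume := by
  refine ⟨(continuous_torusProj B).measurable, ?_⟩
  refine Measure.AbsolutelyContinuous.mk fun s hs h0 => ?_
  obtain ⟨k, C, hC, h⟩ := lintegral_torusProj_mul_le B
  have hm : Measurable fun z : Phase d => s.indicator (1 : UnitAddTorus ι → ℝ≥0∞) (torusProj B z) *
      ENNReal.ofReal ((1 + ‖z‖)⁻¹ ^ k) :=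
    ((measurable_one.indicator hs).comp (continuous_torusProj B).measurable).mul (by fun_prop)
  have h1 := h (s.indicator 1) (measurable_one.indicator hs)
  rw [lintegral_indicator_one hs, h0, mul_zero, nonpos_iff_eq_zero, lintegral_eq_zero_iff hm] at h1
  rw [Measure.map_apply (continuous_torusProj B).measurable hs, measure_eq_zero_iff_ae_notMem]
  filter_upwards [h1] with z hz hzs
  have hzs' : torusProj B z ∈ s := hzs
  simp only [Pi.zero_apply, mul_eq_zero, Set.indicator_of_mem hzs', Pi.one_apply, one_ne_zero,
    false_or, ENNReal.ofReal_eq_zero] at hz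
  exact absurd hz (not_le.2 (by positivity))

end ModInv

end

noncomputable section

namespace ModInv

attribute [local instance] instMeasureSpaceUnitAddCircle

variable {d : ℕ}

/-! ### Expansions of operators commuting with a lattice of time-frequency shifts -/

lemma continuous_rho_comp {X : Type} [TopologicalSpace X] {a : X → Phase d} {u : X → L2 d}
    (ha : Continuous a) (hu : Continuous u) : Continuous fun x => rho (a x) (u x) := by
  rw [continuous_iff_continuousAt]
  intro w
  rw [ContinuousAt, tendsto_iff_norm_sub_tendsto_zero]
  have h1 : Continuous fun x => ‖u x - u w‖ + ‖rho (a x) (u w) - rho (a w) (u w)‖ := by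
    have := (continuous_rho (u w)).comp ha
    have h : Continuous fun x => rho (a x) (u w) := this
    fun_prop
  refine squeeze_zero (fun _ => norm_nonneg _) (fun x => ?_) (by simpa using h1.tendsto w)
  calc _ = ‖rho (a x) (u x - u w) + (rho (a x) (u w) - rho (a w) (u w))‖ := by
        rw [map_sub]; congr 1; abel
    _ ≤ _ := (norm_add_le _ _).trans (by rw [norm_rho])

/-- The phases of ρ(b)ρ(a) and ρ(-a)ρ(-b) cancel: ρ is only projective, but conjugation by ρ is a
genuine action of the additive group. -/
lemma rho_conj_add (X : L2 d →L[ℂ] L2 d) (a b : Phase d) (f : L2 d) :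
    rho (-(a + b)) (X (rho (a + b) f)) = rho (-a) (rho (-b) (X (rho b (rho a f)))) := by
  rw [rho_rho b a, map_smul, map_smul, map_smul, rho_rho, smul_smul, ← Complex.exp_add,
    sympl_neg_left, sympl_neg_right, neg_neg, sympl_comm a b, ← neg_add, add_comm b a]
  simp

/-- `r` is the sequence of coefficients of `R` as a series `∑ r_m ρ(2m)` of time-frequency shifts
over the adjoint lattice. -/
def HasExpansion (Λ : Submodule ℤ (Phase d)) (R : L2 d →L[ℂ] L2 d) (r : adjointLattice Λ → ℂ) :
    Prop :=
  (Summable fun m => ‖r m‖ ^ 2) ∧ ∀ f g : L2 d,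
    (Summable fun m : adjointLattice Λ => ‖⟪g, rho ((2 : ℝ) • (m : Phase d)) f⟫_ℂ‖ ^ 2) →
      HasSum (fun m : adjointLattice Λ => r m * ⟪g, rho ((2 : ℝ) • (m : Phase d)) f⟫_ℂ) ⟪g, R f⟫_ℂ

variable {ι : Type} [Fintype ι] (B : Module.Basis ι ℝ (Phase d))

/-- The operator commutes with the time-frequency shifts by points of `Λ / 2`. -/
def CommutesWithHalf (Λ : Submodule ℤ (Phase d)) (R : L2 d →L[ℂ] L2 d) : Prop :=
  ∀ l ∈ Λ, ∀ f, R (rho ((2⁻¹ : ℝ) • l) f) = rho ((2⁻¹ : ℝ) • l) (R f)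

section Coefficients

variable {B} {R : L2 d →L[ℂ] L2 d} (hR : CommutesWithHalf (latticeOf B) R)
include hR

lemma exists_torusConj (f : L2 d) : ∃ G : C(UnitAddTorus ι, L2 d), ∀ z, G (torusProj B z) =
    rho (-((2⁻¹ : ℝ) • z)) (R (rho ((2⁻¹ : ℝ) • z) f)) := by
  refine exists_continuous_torus B _ ?_ fun z l hl => ?_
  · exact continuous_rho_comp (by fun_prop)
      (R.continuous.comp (continuous_rho_comp (by fun_prop) continuous_const))
  -- The shift by l/2 passes through R and meets its inverse, which is the periodicity.
  · rw [smul_add, rho_conj_add, hR l hl, rho_neg_rho]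

/-- The continuous function on the torus induced by `z ↦ ρ(z/2)* R ρ(z/2) f`. -/
def torusConj (f : L2 d) : C(UnitAddTorus ι, L2 d) := (exists_torusConj hR f).choose

lemma torusConj_torusProj (f : L2 d) (z : Phase d) : torusConj hR f (torusProj B z) =
    rho (-((2⁻¹ : ℝ) • z)) (R (rho ((2⁻¹ : ℝ) • z) f)) :=
  (exists_torusConj hR f).choose_spec z

lemma torusConj_add (f g : L2 d) (y : UnitAddTorus ι) :
    torusConj hR (f + g) y = torusConj hR f y + torusConj hR g y := by
  obtain ⟨z, rfl⟩ := torusProj_surjective B y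
  simp only [torusConj_torusProj, map_add]

lemma torusConj_smul (c : ℂ) (f : L2 d) (y : UnitAddTorus ι) :
    torusConj hR (c • f) y = c • torusConj hR f y := by
  obtain ⟨z, rfl⟩ := torusProj_surjective B y
  simp only [torusConj_torusProj, map_smul]

lemma norm_torusConj_le (f : L2 d) (y : UnitAddTorus ι) : ‖torusConj hR f y‖ ≤ ‖R‖ * ‖f‖ := by
  obtain ⟨z, rfl⟩ := torusProj_surjective B y
  rw [torusConj_torusProj, norm_rho]
  refine (R.le_opNorm _).trans (by rw [norm_rho])

lemma integrable_mFourier_smul_torusConj (n : ι → ℤ) (f : L2 d) :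
    Integrable fun y => UnitAddTorus.mFourier n y • torusConj hR f y :=
  Continuous.integrable_of_hasCompactSupport (by fun_prop) (HasCompactSupport.of_compactSpace _)

/-- The Fourier coefficients of `z ↦ ρ(z/2)* R ρ(z/2)`. -/
def coeffOp (n : ι → ℤ) : L2 d →L[ℂ] L2 d :=
  LinearMap.mkContinuous
    { toFun := fun f => UnitAddTorus.mFourierCoeff (torusConj hR f) n
      map_add' := fun f g => by
        simp only [UnitAddTorus.mFourierCoeff, torusConj_add, smul_add]
        exact integral_add (integrable_mFourier_smul_torusConj hR _ _)
          (integrable_mFourier_smul_torusConj hR _ _)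
      map_smul' := fun c f => by
        simp only [UnitAddTorus.mFourierCoeff, torusConj_smul, RingHom.id_apply]
        rw [← integral_smul]
        simp only [smul_comm c] }
    ‖R‖ fun f => by
      refine (norm_integral_le_of_norm_le_const (C := ‖R‖ * ‖f‖) (.of_forall fun y => ?_)).trans ?_
      · rw [norm_smul]
        refine (mul_le_of_le_one_left (norm_nonneg _) ?_).trans (norm_torusConj_le hR f y)
        exact ((UnitAddTorus.mFourier (-n)).norm_coe_le_norm y).trans UnitAddTorus.mFourier_norm.le
      · simp

lemma coeffOp_apply (n : ι → ℤ) (f : L2 d) :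
    coeffOp hR n f = ∫ y, UnitAddTorus.mFourier (-n) y • torusConj hR f y := rfl

/-- Conjugation by ρ(w/2) translates the function on the torus by w; invariance of Haar measure
moves the translation to the character. -/
lemma rho_coeffOp_rho (m : adjointLattice (latticeOf B)) (w : Phase d) (f : L2 d) :
    rho (-((2⁻¹ : ℝ) • w)) (coeffOp hR (adjointEquiv B m) (rho ((2⁻¹ : ℝ) • w) f)) =
      Complex.exp (2 * Real.pi * Complex.I * (sympl m w : ℝ)) •
        coeffOp hR (adjointEquiv B m) f := by
  rw [coeffOp_apply, coeffOp_apply, ← ContinuousLinearMap.integral_comp_comm _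
    (integrable_mFourier_smul_torusConj hR _ _),
    ← integral_add_right_eq_self (fun y => UnitAddTorus.mFourier (-adjointEquiv B m) y •
      torusConj hR f y) (torusProj B w), ← integral_smul]
  refine integral_congr_ae (.of_forall fun y => ?_)
  obtain ⟨z, rfl⟩ := torusProj_surjective B y
  simp only [map_smul]
  rw [← torusProj_add, torusConj_torusProj, torusConj_torusProj, smul_smul, add_comm z w, smul_add,
    rho_conj_add, ← adjointEquiv_neg, mFourier_torusProj, mFourier_torusProj, ← Complex.exp_add]
  congr 2
  simp only [AddSubgroup.coe_neg, sympl_neg_left, sympl_add_right]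
  push_cast; ring

/-- The operator ρ(2m) satisfies the same covariance as the m-th coefficient, so ρ(-2m) times that
coefficient commutes with all shifts and is scalar by Schur's lemma. -/
lemma exists_coeffOp_eq (m : adjointLattice (latticeOf B)) :
    ∃ c : ℂ, ∀ f, coeffOp hR (adjointEquiv B m) f = c • rho ((2 : ℝ) • (m : Phase d)) f := by
  obtain ⟨c, hc⟩ := exists_eq_smul_of_commute
    (rho (-((2 : ℝ) • (m : Phase d))) ∘L coeffOp hR (adjointEquiv B m)) fun z f => by
      have h := rho_coeffOp_rho hR m ((2 : ℝ) • z) f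
      rw [smul_smul, inv_mul_cancel₀ two_ne_zero, one_smul] at h
      have h' := congrArg (rho z) h
      rw [rho_rho_neg, map_smul] at h'
      rw [ContinuousLinearMap.comp_apply, ContinuousLinearMap.comp_apply, h', map_smul,
        rho_comm _ z, smul_smul, ← Complex.exp_add, sympl_neg_left, sympl_smul_left,
        sympl_smul_right]
      simp
  refine ⟨c, fun f => ?_⟩
  have h := congrArg (rho ((2 : ℝ) • (m : Phase d))) (hc f)
  rwa [ContinuousLinearMap.comp_apply, rho_rho_neg, map_smul] at h

lemma inner_coeffOp (n : ι → ℤ) (f g : L2 d) :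
    ⟪g, coeffOp hR n f⟫_ℂ = ∫ y, UnitAddTorus.mFourier (-n) y * ⟪g, torusConj hR f y⟫_ℂ := by
  rw [coeffOp_apply, ← integral_inner (integrable_mFourier_smul_torusConj hR _ _)]
  simp only [inner_smul_right]

/-- For a unit vector f', the functions y ↦ χ_m(y) ρ(2m)f' are orthonormal in the L²(ℝᵈ)-valued
functions on the torus, orthogonality coming from the characters alone. The inner product of the
m-th one with the conjugation orbit of f' is r_m, so Bessel's inequality applies. -/
lemma summable_sq_of_coeffOp_eq {r : adjointLattice (latticeOf B) → ℂ}
    (hr : ∀ m f, coeffOp hR (adjointEquiv B m) f = r m • rho ((2 : ℝ) • (m : Phase d)) f)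
    {f : L2 d} (hf : f ≠ 0) : Summable fun m => ‖r m‖ ^ 2 := by
  let e : adjointLattice (latticeOf B) → C(UnitAddTorus ι, L2 d) := fun m =>
    ⟨fun y => UnitAddTorus.mFourier (adjointEquiv B m) y • rho ((2 : ℝ) • (m : Phase d))
      ((‖f‖⁻¹ : ℂ) • f), by fun_prop⟩
  have hn : ‖((‖f‖⁻¹ : ℂ) • f)‖ = 1 := by
    rw [norm_smul]; simp [hf]
  set f' : L2 d := (‖f‖⁻¹ : ℂ) • f
  have hin : ∀ a b : C(UnitAddTorus ι, L2 d), ⟪ContinuousMap.toLp 2 volume ℂ a,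
      ContinuousMap.toLp 2 volume ℂ b⟫_ℂ = ∫ y, ⟪a y, b y⟫_ℂ := fun a b => by
    rw [L2.inner_def]
    refine integral_congr_ae ?_
    filter_upwards [ContinuousMap.coeFn_toLp (p := 2) (𝕜 := ℂ) volume a,
      ContinuousMap.coeFn_toLp (p := 2) (𝕜 := ℂ) volume b] with y h1 h2
    rw [h1, h2]
  have ho : Orthonormal ℂ fun m => ContinuousMap.toLp 2 (volume : Measure (UnitAddTorus ι)) ℂ (e m) := by
    classical
    rw [orthonormal_iff_ite]
    intro m m'
    have h := orthonormal_iff_ite.1 (UnitAddTorus.orthonormal_mFourier (d := ι))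
      (adjointEquiv B m) (adjointEquiv B m')
    rw [ContinuousMap.inner_toLp] at h
    have h2 : ∫ y, ⟪e m y, e m' y⟫_ℂ = (∫ y, UnitAddTorus.mFourier (adjointEquiv B m') y *
        conj (UnitAddTorus.mFourier (adjointEquiv B m) y)) *
        ⟪rho ((2 : ℝ) • (m : Phase d)) f', rho ((2 : ℝ) • (m' : Phase d)) f'⟫_ℂ := by
      rw [← integral_mul_const]
      refine integral_congr_ae (.of_forall fun y => ?_)
      simp only [e, ContinuousMap.coe_mk, inner_smul_left, inner_smul_right]
      ring
    rw [hin, h2, h]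
    simp only [EmbeddingLike.apply_eq_iff_eq]
    split_ifs with hm
    · subst hm
      rw [inner_rho_rho, inner_self_eq_norm_sq_to_K, hn]; simp
    · rw [zero_mul]
  have hs := ho.inner_products_summable (ContinuousMap.toLp 2 volume ℂ (torusConj hR f'))
  refine hs.congr fun m => ?_
  rw [hin]
  simp only [e, ContinuousMap.coe_mk, inner_smul_left, ← UnitAddTorus.mFourier_neg]
  rw [← inner_coeffOp, hr, inner_smul_right, inner_rho_rho, inner_self_eq_norm_sq_to_K, hn]
  simp

/-- The scalar function y ↦ ⟪g, ρ(-z/2)Rρ(z/2)f⟫ is continuous with coefficients r_m ⟪g, ρ(2m)f⟫. As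
products of two ℓ² sequences these are summable, so the Fourier series converges pointwise, and its
value at 0 is ⟪g, Rf⟫. -/
lemma hasSum_of_coeffOp_eq {r : adjointLattice (latticeOf B) → ℂ}
    (hr : ∀ m f, coeffOp hR (adjointEquiv B m) f = r m • rho ((2 : ℝ) • (m : Phase d)) f)
    (h2 : Summable fun m => ‖r m‖ ^ 2) (f g : L2 d)
    (h : Summable fun m : adjointLattice (latticeOf B) =>
      ‖⟪g, rho ((2 : ℝ) • (m : Phase d)) f⟫_ℂ‖ ^ 2) :
    HasSum (fun m : adjointLattice (latticeOf B) => r m * ⟪g, rho ((2 : ℝ) • (m : Phase d)) f⟫_ℂ)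
      ⟪g, R f⟫_ℂ := by
  let F : C(UnitAddTorus ι, ℂ) := ⟨fun y => ⟪g, torusConj hR f y⟫_ℂ, by fun_prop⟩
  have hc : ∀ m, UnitAddTorus.mFourierCoeff F (adjointEquiv B m) =
      r m * ⟪g, rho ((2 : ℝ) • (m : Phase d)) f⟫_ℂ := fun m => by
    rw [← inner_smul_right, ← hr, inner_coeffOp]; rfl
  have hs : Summable (UnitAddTorus.mFourierCoeff F) := by
    rw [← (adjointEquiv B).summable_iff]
    refine Summable.of_norm_bounded (h2.add h) fun m => ?_
    rw [Function.comp_apply, hc, norm_mul]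
    nlinarith [sq_nonneg (‖r m‖ - ‖⟪g, rho ((2 : ℝ) • (m : Phase d)) f⟫_ℂ‖),
      sq_nonneg ‖r m‖, sq_nonneg ‖⟪g, rho ((2 : ℝ) • (m : Phase d)) f⟫_ℂ‖]
  have hF := UnitAddTorus.hasSum_mFourier_series_apply_of_summable hs (torusProj B 0)
  rw [← (adjointEquiv B).hasSum_iff] at hF
  have h0 : F (torusProj B 0) = ⟪g, R f⟫_ℂ := by
    change ⟪g, torusConj hR f (torusProj B 0)⟫_ℂ = _
    rw [torusConj_torusProj]; simp [rho_zero]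
  rw [h0] at hF
  refine hF.congr_fun fun m => ?_
  rw [Function.comp_apply, hc, mFourier_torusProj]
  simp [sympl]

theorem exists_hasExpansion : ∃ r, HasExpansion (latticeOf B) R r := by
  by_cases hf : ∃ f : L2 d, f ≠ 0
  · obtain ⟨f, hf⟩ := hf
    choose r hr using exists_coeffOp_eq hR
    have h2 := summable_sq_of_coeffOp_eq hR hr hf
    exact ⟨r, h2, hasSum_of_coeffOp_eq hR hr h2⟩
  · push Not at hf
    refine ⟨0, by simp, fun f g _ => ?_⟩
    simp [hf f]

end Coefficients

/-! ### Bessel bounds -/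

/-- A family in a Hilbert space whose Gram matrix is dominated by a summable convolution kernel
is a Bessel family. -/
lemma summable_inner_of_gram_le {H I : Type} [NormedAddCommGroup H] [InnerProductSpace ℂ H]
    [AddCommGroup I] (u : I → H) (k : I → ℝ) (hk : Summable k) (hk0 : ∀ i, 0 ≤ k i)
    (hu : ∀ i j, ‖⟪u i, u j⟫_ℂ‖ ≤ k (j - i)) (g : H) : Summable fun i => ‖⟪u i, g⟫_ℂ‖ ^ 2 := by
  refine summable_of_sum_le (fun _ => by positivity) (c := (∑' i, k i) * ‖g‖ ^ 2) fun s => ?_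
  set a : I → ℂ := fun i => ⟪u i, g⟫_ℂ
  set A := ∑ i ∈ s, ‖a i‖ ^ 2 with hA
  set K := ∑' i, k i
  have hA0 : 0 ≤ A := Finset.sum_nonneg fun _ _ => by positivity
  have hK1 : ∀ i, ∑ j ∈ s, k (j - i) ≤ K := fun i => by
    have := Summable.sum_le_tsum (f := fun j => k (j - i)) s (fun _ _ => hk0 _)
      ((Equiv.subRight i).summable_iff.2 hk)
    exact this.trans (le_of_eq ((Equiv.subRight i).tsum_eq k))
  have hK2 : ∀ j, ∑ i ∈ s, k (j - i) ≤ K := fun j => by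
    have := Summable.sum_le_tsum (f := fun i => k (j - i)) s (fun _ _ => hk0 _)
      ((Equiv.subLeft j).summable_iff.2 hk)
    exact this.trans (le_of_eq ((Equiv.subLeft j).tsum_eq k))
  -- Duality: A = ⟪v, g⟫ ≤ ‖v‖‖g‖, while the Schur test with row and column sums at most K gives
  -- ‖v‖² ≤ AK. Squaring and cancelling A leaves A ≤ K‖g‖².
  set v := ∑ i ∈ s, a i • u i
  have hv : ⟪v, g⟫_ℂ = A := by
    rw [sum_inner, hA]
    push_cast
    refine Finset.sum_congr rfl fun i _ => ?_
    rw [inner_smul_left, ← Complex.conj_mul']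
  have hvv : ‖v‖ ^ 2 ≤ A * K := by
    have h1 : ⟪v, v⟫_ℂ = ∑ i ∈ s, ∑ j ∈ s, conj (a i) * (a j * ⟪u i, u j⟫_ℂ) := by
      rw [sum_inner]
      refine Finset.sum_congr rfl fun i _ => ?_
      rw [inner_smul_left, inner_sum, Finset.mul_sum]
      simp only [inner_smul_right]
    have h2 : ‖v‖ ^ 2 = ‖⟪v, v⟫_ℂ‖ := by
      rw [inner_self_eq_norm_sq_to_K]; simp
    rw [h2, h1]
    have h3 : ∀ i ∈ s, ∀ j ∈ s, ‖conj (a i) * (a j * ⟪u i, u j⟫_ℂ)‖ ≤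
        2⁻¹ * (‖a i‖ ^ 2 * k (j - i)) + 2⁻¹ * (‖a j‖ ^ 2 * k (j - i)) := fun i _ j _ => by
      rw [norm_mul, norm_mul, RCLike.norm_conj]
      have h4 : ‖a i‖ * ‖a j‖ ≤ 2⁻¹ * ‖a i‖ ^ 2 + 2⁻¹ * ‖a j‖ ^ 2 := by
        nlinarith [sq_nonneg (‖a i‖ - ‖a j‖)]
      calc _ = ‖a i‖ * ‖a j‖ * ‖⟪u i, u j⟫_ℂ‖ := by ring
        _ ≤ (2⁻¹ * ‖a i‖ ^ 2 + 2⁻¹ * ‖a j‖ ^ 2) * k (j - i) := by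
          gcongr
          exact hu i j
        _ = _ := by ring
    have h5 : ∑ i ∈ s, ∑ j ∈ s, ‖a i‖ ^ 2 * k (j - i) ≤ A * K := by
      rw [hA, Finset.sum_mul]
      refine Finset.sum_le_sum fun i _ => ?_
      rw [← Finset.mul_sum]
      exact mul_le_mul_of_nonneg_left (hK1 i) (by positivity)
    have h6 : ∑ i ∈ s, ∑ j ∈ s, ‖a j‖ ^ 2 * k (j - i) ≤ A * K := by
      rw [Finset.sum_comm, hA, Finset.sum_mul]
      refine Finset.sum_le_sum fun j _ => ?_
      rw [← Finset.mul_sum]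
      exact mul_le_mul_of_nonneg_left (hK2 j) (by positivity)
    calc _ ≤ ∑ i ∈ s, ∑ j ∈ s, (2⁻¹ * (‖a i‖ ^ 2 * k (j - i)) + 2⁻¹ * (‖a j‖ ^ 2 * k (j - i))) :=
          norm_sum_le_of_le s fun i hi => norm_sum_le_of_le s fun j hj => h3 i hi j hj
      _ = 2⁻¹ * (∑ i ∈ s, ∑ j ∈ s, ‖a i‖ ^ 2 * k (j - i)) +
          2⁻¹ * ∑ i ∈ s, ∑ j ∈ s, ‖a j‖ ^ 2 * k (j - i) := by
          simp only [Finset.sum_add_distrib, Finset.mul_sum]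
      _ ≤ _ := by linarith
  have hle : A ≤ ‖v‖ * ‖g‖ := by
    have := norm_inner_le_norm (𝕜 := ℂ) v g
    rw [hv] at this
    simpa [abs_of_nonneg hA0] using this
  rcases hA0.eq_or_lt with h0 | h0
  · rw [← h0]
    exact mul_nonneg (tsum_nonneg hk0) (by positivity)
  · have h7 : A * A ≤ A * (K * ‖g‖ ^ 2) := by
      calc A * A ≤ (‖v‖ * ‖g‖) * (‖v‖ * ‖g‖) := mul_self_le_mul_self hA0 hle
        _ = ‖v‖ ^ 2 * ‖g‖ ^ 2 := by ring
        _ ≤ A * K * ‖g‖ ^ 2 := by gcongr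
        _ = _ := by ring
    exact le_of_mul_le_mul_left h7 h0

lemma norm_exp_pi_smul_inner (x : ℝ) (g h : L2 d) :
    ‖⟪g, Complex.exp (Real.pi * Complex.I * x) • h⟫_ℂ‖ = ‖⟪g, h⟫_ℂ‖ := by
  rw [inner_smul_right, norm_mul, norm_exp_I_mul, one_mul]

/-- The Gram matrix of the family ρ(2m)f has entries of modulus |A(f,f)(2(m' - m))|, a summable
convolution kernel on Λ°. -/
lemma summable_sq_inner_rho_schwartz (f : 𝓢(Pos d, ℂ)) (g : L2 d) :
    Summable fun m : adjointLattice (latticeOf B) =>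
      ‖⟪g, rho ((2 : ℝ) • (m : Phase d)) (f.toLp 2)⟫_ℂ‖ ^ 2 := by
  have h := summable_inner_of_gram_le
    (fun m : adjointLattice (latticeOf B) => rho ((2 : ℝ) • (m : Phase d)) (f.toLp 2))
    (fun m => ‖double (ambiguity f f) m‖) (summable_adjointLattice B _) (fun _ => norm_nonneg _)
    (fun m m' => by
      rw [inner_rho_left, rho_rho, norm_exp_pi_smul_inner, double_apply, ← conj_ambiguity,
        RCLike.norm_conj, AddSubgroup.coe_sub, smul_sub, neg_add_eq_sub]) g
  refine h.congr fun m => ?_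
  rw [norm_inner_symm]

lemma summable_sq_inner_schwartz_rho (f : L2 d) (g : 𝓢(Pos d, ℂ)) :
    Summable fun m : adjointLattice (latticeOf B) =>
      ‖⟪g.toLp 2, rho ((2 : ℝ) • (m : Phase d)) f⟫_ℂ‖ ^ 2 := by
  have h := (Equiv.neg _).summable_iff.2 (summable_sq_inner_rho_schwartz B g f)
  refine h.congr fun m => ?_
  simp only [Function.comp_apply, Equiv.neg_apply, AddSubgroup.coe_neg, smul_neg]
  rw [norm_inner_symm, inner_rho_left, neg_neg]

end ModInv

end

noncomputable section

namespace ModInv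

attribute [local instance] instMeasureSpaceUnitAddCircle

variable {d : ℕ}

/-! ### Composition of expansions -/

/-- The terms `r_i q_j k_{i + j}` are summable for `r, q ∈ ℓ²` and `k ∈ ℓ¹`. -/
lemma summable_mul_mul_add {I : Type} [AddCommGroup I] {r q k : I → ℂ}
    (hr : Summable fun i => ‖r i‖ ^ 2) (hq : Summable fun i => ‖q i‖ ^ 2)
    (hk : Summable fun i => ‖k i‖) : Summable fun p : I × I => r p.1 * q p.2 * k (p.1 + p.2) := by
  -- The term is dominated by (|r_i|² + |q_j|²)|k_{i+j}|. The bijections (i,j) ↦ (i, i+j) and (i,j)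
  -- ↦ (j, i+j) turn each half into a product of two summable families.
  let e₁ : I × I ≃ I × I :=
    { toFun := fun p => (p.1, p.1 + p.2)
      invFun := fun p => (p.1, p.2 - p.1)
      left_inv := fun p => by simp
      right_inv := fun p => by simp }
  let e₂ : I × I ≃ I × I :=
    { toFun := fun p => (p.2, p.1 + p.2)
      invFun := fun p => (p.2 - p.1, p.1)
      left_inv := fun p => by simp
      right_inv := fun p => by simp }
  have h1 := e₁.summable_iff.2 (hr.mul_of_nonneg hk (fun _ => by positivity) fun _ => norm_nonneg _)
  have h2 := e₂.summable_iff.2 (hq.mul_of_nonneg hk (fun _ => by positivity) fun _ => norm_nonneg _)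
  refine Summable.of_norm_bounded (h1.add h2) fun p => ?_
  change ‖r p.1 * q p.2 * k (p.1 + p.2)‖ ≤
    ‖r p.1‖ ^ 2 * ‖k (p.1 + p.2)‖ + ‖q p.2‖ ^ 2 * ‖k (p.1 + p.2)‖
  rw [norm_mul, norm_mul, ← add_mul]
  gcongr
  nlinarith [sq_nonneg (‖r p.1‖ - ‖q p.2‖), sq_nonneg ‖r p.1‖, sq_nonneg ‖q p.2‖]

lemma summable_mul_of_sq {I : Type} {r q : I → ℂ}
    (hr : Summable fun i => ‖r i‖ ^ 2) (hq : Summable fun i => ‖q i‖ ^ 2) :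
    Summable fun i => r i * q i := by
  refine Summable.of_norm_bounded (hr.add hq) fun i => ?_
  rw [norm_mul]
  nlinarith [sq_nonneg (‖r i‖ - ‖q i‖), sq_nonneg ‖r i‖, sq_nonneg ‖q i‖]

/-- A double sum already known to be summable can be evaluated by any iterated sum. -/
lemma hasSum_prod_of_iterated {I J : Type} {F : I × J → ℂ} (hF : Summable F) {G : J → ℂ}
    (hG : ∀ j, HasSum (fun i => F (i, j)) (G j)) {a : ℂ} (ha : HasSum G a) : HasSum F a := by
  have h1 := (Equiv.prodComm J I).hasSum_iff.2 hF.hasSum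
  rw [ha.unique (h1.prod_fiberwise hG)]
  exact hF.hasSum

/-- The only place where integrality of 2Ω enters: the cocycle is exp(πi·4Ω(m,m')), and 4Ω(m,m') is
an even integer. -/
lemma rho_add_of_two_sympl {Λ : Submodule ℤ (Phase d)}
    (hΛ : ∀ z ∈ adjointLattice Λ, ∀ w ∈ adjointLattice Λ, ∃ n : ℤ, 2 * sympl z w = n)
    (m m' : adjointLattice Λ) (f : L2 d) :
    rho ((2 : ℝ) • (m : Phase d)) (rho ((2 : ℝ) • (m' : Phase d)) f) =
      rho ((2 : ℝ) • ((m : Phase d) + (m' : Phase d))) f := by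
  obtain ⟨n, hn⟩ := hΛ m m.2 m' m'.2
  have e : (Real.pi * Complex.I * ((2 * (2 * sympl (m : Phase d) (m' : Phase d)) : ℝ) : ℂ)) = n * (2 * Real.pi * Complex.I) := by
    rw [hn]; push_cast; ring
  rw [rho_rho, smul_add, sympl_smul_left, sympl_smul_right, e, Complex.exp_int_mul_two_pi_mul_I,
    one_smul]

lemma HasExpansion.opCheck {Λ : Submodule ℤ (Phase d)} {R : L2 d →L[ℂ] L2 d}
    {r : adjointLattice Λ → ℂ} (h : HasExpansion Λ R r) :
    HasExpansion Λ (opCheck R) fun m => r (-m) := by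
  refine ⟨(Equiv.neg (adjointLattice Λ)).summable_iff (f := fun m => ‖r m‖ ^ 2) |>.2 h.1, fun f g hs => ?_⟩
  have e : ∀ m : adjointLattice Λ, ⟪parity d g, rho ((2 : ℝ) • ((-m : adjointLattice Λ) : Phase d))
      (parity d f)⟫_ℂ = ⟪g, rho ((2 : ℝ) • (m : Phase d)) f⟫_ℂ := fun m => by
    rw [← inner_parity_right, parity_rho, parity_parity, AddSubgroup.coe_neg, smul_neg, neg_neg]
  have h2 := h.2 (parity d f) (parity d g) (by
    rw [← (Equiv.neg (adjointLattice Λ)).summable_iff]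
    refine hs.congr fun m => ?_
    rw [Function.comp_apply, Equiv.neg_apply, e])
  rw [← (Equiv.neg (adjointLattice Λ)).hasSum_iff, ← inner_parity_right] at h2
  refine h2.congr_fun fun m => ?_
  rw [Function.comp_apply, Equiv.neg_apply, e]

variable {ι : Type} [Fintype ι] {B : Module.Basis ι ℝ (Phase d)}

/-- The matrix coefficient `⟪g, ρ(2z) f⟫`. -/
def shiftCoeff (f g : L2 d) (z : Phase d) : ℂ := ⟪g, rho ((2 : ℝ) • z) f⟫_ℂ

lemma shiftCoeff_schwartz (f g : 𝓢(Pos d, ℂ)) (z : Phase d) :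
    shiftCoeff (f.toLp 2) (g.toLp 2) z = double (conjS (ambiguity g f)) z := by
  rw [shiftCoeff, ← conj_ambiguity]; rfl

lemma summable_shiftCoeff (f g : 𝓢(Pos d, ℂ)) : Summable fun m : adjointLattice (latticeOf B) =>
    ‖shiftCoeff (f.toLp 2) (g.toLp 2) m‖ := by
  simp only [shiftCoeff_schwartz]
  exact summable_adjointLattice B _

/-- Q is expanded against the vectors F and R*G, then R against ρ(2m)F and G. No regularity is known
for R*G or ρ(2m)F, so the square summability assumptions leave one vector arbitrary. -/
lemma HasExpansion.hasSum_comp_of_summable {Λ : Submodule ℤ (Phase d)} {R Q : L2 d →L[ℂ] L2 d}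
    {r q : adjointLattice Λ → ℂ}
    (hΛ : ∀ z ∈ adjointLattice Λ, ∀ w ∈ adjointLattice Λ, ∃ n : ℤ, 2 * sympl z w = n)
    (hR : HasExpansion Λ R r) (hQ : HasExpansion Λ Q q) (F G : L2 d)
    (hF : ∀ H, Summable fun m : adjointLattice Λ => ‖⟪H, rho ((2 : ℝ) • (m : Phase d)) F⟫_ℂ‖ ^ 2)
    (hG : ∀ H, Summable fun m : adjointLattice Λ => ‖⟪G, rho ((2 : ℝ) • (m : Phase d)) H⟫_ℂ‖ ^ 2)
    (hFG : Summable fun m : adjointLattice Λ => ‖shiftCoeff F G m‖) :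
    HasSum (fun p : adjointLattice Λ × adjointLattice Λ =>
      r p.1 * q p.2 * shiftCoeff F G (p.1 + p.2 : adjointLattice Λ)) ⟪G, R (Q F)⟫_ℂ := by
  have h3 : HasSum (fun m : adjointLattice Λ => q m * ⟪G, R (rho ((2 : ℝ) • (m : Phase d)) F)⟫_ℂ)
      ⟪G, R (Q F)⟫_ℂ := by
    have h := hQ.2 F (ContinuousLinearMap.adjoint R G) (hF _)
    simpa only [ContinuousLinearMap.adjoint_inner_left] using h
  refine hasSum_prod_of_iterated (summable_mul_mul_add hR.1 hQ.1 hFG) (fun m => ?_) h3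
  have h2 := (hR.2 (rho ((2 : ℝ) • (m : Phase d)) F) G (hG _)).mul_left (q m)
  refine h2.congr_fun fun l => ?_
  rw [rho_add_of_two_sympl hΛ, shiftCoeff, AddSubgroup.coe_add]
  ring

theorem HasExpansion.hasSum_comp {R Q : L2 d →L[ℂ] L2 d} {r q : adjointLattice (latticeOf B) → ℂ}
    (hΛ : ∀ z ∈ adjointLattice (latticeOf B), ∀ w ∈ adjointLattice (latticeOf B),
      ∃ n : ℤ, 2 * sympl z w = n)
    (hR : HasExpansion (latticeOf B) R r) (hQ : HasExpansion (latticeOf B) Q q)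
    (f g : 𝓢(Pos d, ℂ)) :
    HasSum (fun p : adjointLattice (latticeOf B) × adjointLattice (latticeOf B) =>
      r p.1 * q p.2 * shiftCoeff (f.toLp 2) (g.toLp 2) (p.1 + p.2 : adjointLattice (latticeOf B)))
      ⟪g.toLp 2, R (Q (f.toLp 2))⟫_ℂ :=
  hR.hasSum_comp_of_summable hΛ hQ _ _ (summable_sq_inner_rho_schwartz B f)
    (fun H => summable_sq_inner_schwartz_rho B H g) (summable_shiftCoeff f g)

/-- The double series of RQ and QR agree after exchanging the indices, since the shift depends only
on their sum. -/
theorem HasExpansion.comm {R Q : L2 d →L[ℂ] L2 d} {r q : adjointLattice (latticeOf B) → ℂ}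
    (hΛ : ∀ z ∈ adjointLattice (latticeOf B), ∀ w ∈ adjointLattice (latticeOf B),
      ∃ n : ℤ, 2 * sympl z w = n)
    (hR : HasExpansion (latticeOf B) R r) (hQ : HasExpansion (latticeOf B) Q q) :
    R ∘L Q = Q ∘L R := by
  refine clm_eq_of_forall_inner fun f g => ?_
  have h1 := hR.hasSum_comp hΛ hQ f g
  have h2 := (Equiv.prodComm (adjointLattice (latticeOf B))
    (adjointLattice (latticeOf B))).hasSum_iff.2 (hQ.hasSum_comp hΛ hR f g)
  refine h1.unique (h2.congr_fun fun p => ?_)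
  simp only [Function.comp_apply, Equiv.prodComm_apply, Prod.fst_swap, Prod.snd_swap]
  rw [add_comm p.2, mul_comm (q p.2)]

/-! ### Modulation invariant operators -/

lemma opModulation_apply (w : Phase d) (S : L2 d →L[ℂ] L2 d) (f : L2 d) :
    opModulation w S f = rho ((2⁻¹ : ℝ) • w) (S (rho ((2⁻¹ : ℝ) • w) f)) := by
  simp only [opModulation, rho, smul_apply, ContinuousLinearMap.comp_apply, map_smul, smul_smul,
    ← Complex.exp_add]
  congr 2
  simp only [Prod.smul_fst, Prod.smul_snd, inner_smul_left, inner_smul_right]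
  simp
  ring

/-- Parity turns ρ(λ/2) into ρ(-λ/2), so composing with P converts two-sided invariance into
commutation. -/
lemma IsModulationInvariant.commutesWithHalf {Λ : Submodule ℤ (Phase d)} {S : L2 d →L[ℂ] L2 d}
    (hS : IsModulationInvariant Λ S) : CommutesWithHalf Λ (S ∘L parity d) := fun l hl f => by
  have h := congrArg (· (rho (-((2⁻¹ : ℝ) • l)) (parity d f))) (hS l hl)
  simp only [opModulation_apply, rho_rho_neg] at h
  rw [ContinuousLinearMap.comp_apply, ContinuousLinearMap.comp_apply, parity_rho, ← h]

end ModInv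

end

noncomputable section

namespace ModInv

attribute [local instance] instMeasureSpaceUnitAddCircle

variable {d : ℕ}

/-! ### Construction of tempered distributions -/

lemma exists_temperedDistribution (A : 𝓢(Phase d, ℂ) → ℂ) (hadd : ∀ φ ψ, A (φ + ψ) = A φ + A ψ)
    (hsmul : ∀ (c : ℂ) φ, A (c • φ) = c * A φ) (k : ℕ) {C : ℝ} (hC : 0 ≤ C)
    (h : ∀ φ, ‖A φ‖ ≤ C * decaySeminorm k φ) : ∃ u : 𝓢'(Phase d, ℂ), ∀ φ, u φ = A φ := by
  let L : 𝓢(Phase d, ℂ) →L[ℂ] ℂ := mkCLMtoNormedSpace A hadd hsmul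
    ⟨Finset.Iic (k, 0), C * 2 ^ k, by positivity, fun φ => (h φ).trans (le_of_eq (by
      rw [decaySeminorm, ← mul_assoc]; rfl))⟩
  exact ⟨ContinuousLinearMap.toPointwiseConvergenceCLM _ _ _ _ L, fun φ => rfl⟩

lemma exists_isDiracSeries {I : Type} (p : I → Phase d) (a : I → ℂ) (k : ℕ)
    (h : Summable fun i => ‖a i‖ * (1 + ‖p i‖)⁻¹ ^ k) :
    ∃ u : 𝓢'(Phase d, ℂ), IsDiracSeries p a u := by
  have hb : ∀ (φ : 𝓢(Phase d, ℂ)) i,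
      ‖a i * φ (p i)‖ ≤ ‖a i‖ * (1 + ‖p i‖)⁻¹ ^ k * decaySeminorm k φ := fun φ i => by
    rw [norm_mul, mul_assoc, mul_comm (_ ^ k)]
    exact mul_le_mul_of_nonneg_left (norm_le_decaySeminorm k φ _) (norm_nonneg _)
  have hs : ∀ φ : 𝓢(Phase d, ℂ), Summable fun i => a i * φ (p i) := fun φ =>
    Summable.of_norm_bounded (h.mul_right _) (hb φ)
  obtain ⟨u, hu⟩ := exists_temperedDistribution (fun φ => ∑' i, a i * φ (p i))
    (fun φ ψ => by
      rw [← (hs φ).tsum_add (hs ψ)]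
      simp only [add_apply, mul_add])
    (fun c φ => by
      rw [← tsum_mul_left]
      simp only [smul_apply, smul_eq_mul, mul_left_comm]) k
    (C := ∑' i, ‖a i‖ * (1 + ‖p i‖)⁻¹ ^ k) (tsum_nonneg fun _ => by positivity) (fun φ => by
      rw [← tsum_mul_right]
      exact tsum_of_norm_bounded (h.mul_right _).hasSum (hb φ))
  exact ⟨u, fun φ => by rw [hu]; exact (hs φ).hasSum⟩

/-! ### Periodic functions with square summable Fourier coefficients -/

variable {ι : Type} [Fintype ι] (B : Module.Basis ι ℝ (Phase d))

/-- Square integrable functions on the torus. -/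
abbrev TorusL2 (ι : Type) [Fintype ι] : Type := Lp ℂ 2 (volume : Measure (UnitAddTorus ι))

/-- The Riesz-Fischer theorem. -/
lemma exists_torusL2_of_coeff (c : (ι → ℤ) → ℂ) (hc : Summable fun n => ‖c n‖ ^ 2) :
    ∃ A : TorusL2 ι, ∀ n, UnitAddTorus.mFourierCoeff A n = c n := by
  have h : Memℓp c 2 := memℓp_gen (by simpa using hc)
  refine ⟨UnitAddTorus.mFourierBasis.repr.symm ⟨c, h⟩, fun n => ?_⟩
  rw [← UnitAddTorus.mFourierBasis_repr, LinearIsometryEquiv.apply_symm_apply]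

lemma measurable_comp_torusProj (A : TorusL2 ι) : Measurable fun z => A (torusProj B z) :=
  (Lp.stronglyMeasurable A).measurable.comp (continuous_torusProj B).measurable

/-- Cauchy-Schwarz puts the product in L¹ of the torus, and periodic L¹ functions are integrable
against Schwartz functions. Two factors are kept because the symbol of ST is such a product. -/
lemma exists_lintegral_bound : ∃ (k : ℕ) (C : ℝ), 0 ≤ C ∧ ∀ (φ : 𝓢(Phase d, ℂ)) (A A' : TorusL2 ι),
    ∫⁻ z, ‖A (torusProj B z) * A' (torusProj B z) * φ z‖ₑ ≤
      ENNReal.ofReal (C * decaySeminorm k φ * (‖A‖ * ‖A'‖)) := by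
  obtain ⟨k, C, hC, h⟩ := lintegral_torusProj_mul_schwartz_le B
  refine ⟨k, C.toReal, ENNReal.toReal_nonneg, fun φ A A' => ?_⟩
  have hd : 0 ≤ decaySeminorm k φ := by unfold decaySeminorm; positivity
  have hm : Measurable fun y => ‖A y * A' y‖ₑ :=
    ((Lp.stronglyMeasurable A).measurable.mul (Lp.stronglyMeasurable A').measurable).enorm
  have h1 := h φ _ hm
  have h2 : ∫⁻ y, ‖A y * A' y‖ₑ ≤ ENNReal.ofReal (‖A‖ * ‖A'‖) := by
    have h3 := eLpNorm_smul_le_mul_eLpNorm (p := 2) (q := 2) (r := 1)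
      (Lp.aestronglyMeasurable A') (Lp.aestronglyMeasurable A)
    rw [eLpNorm_one_eq_lintegral_enorm] at h3
    refine h3.trans (le_of_eq ?_)
    rw [ENNReal.ofReal_mul (norm_nonneg _), Lp.norm_def, Lp.norm_def,
      ENNReal.ofReal_toReal (Lp.eLpNorm_ne_top _), ENNReal.ofReal_toReal (Lp.eLpNorm_ne_top _)]
  calc _ = ∫⁻ z, ‖A (torusProj B z) * A' (torusProj B z)‖ₑ * ‖φ z‖ₑ := by
        simp only [enorm_mul]
    _ ≤ _ := h1
    _ ≤ C * ENNReal.ofReal (decaySeminorm k φ) * ENNReal.ofReal (‖A‖ * ‖A'‖) := by gcongr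
    _ = _ := by
      rw [ENNReal.ofReal_mul (p := C.toReal * decaySeminorm k φ) (by positivity),
        ENNReal.ofReal_mul (p := C.toReal) ENNReal.toReal_nonneg,
        ENNReal.ofReal_toReal hC]

lemma integrable_torus_mul (φ : 𝓢(Phase d, ℂ)) (A A' : TorusL2 ι) :
    Integrable fun z => A (torusProj B z) * A' (torusProj B z) * φ z := by
  obtain ⟨k, C, hC, h⟩ := exists_lintegral_bound B
  refine ⟨((measurable_comp_torusProj B A).mul (measurable_comp_torusProj B A')).mul
    φ.continuous.measurable |>.aestronglyMeasurable, ?_⟩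
  exact (h φ A A').trans_lt ENNReal.ofReal_lt_top

lemma exists_integral_bound : ∃ (k : ℕ) (C : ℝ), 0 ≤ C ∧ ∀ (φ : 𝓢(Phase d, ℂ)) (A A' : TorusL2 ι),
    ‖∫ z, A (torusProj B z) * A' (torusProj B z) * φ z‖ ≤
      C * decaySeminorm k φ * (‖A‖ * ‖A'‖) := by
  obtain ⟨k, C, hC, h⟩ := exists_lintegral_bound B
  refine ⟨k, C, hC, fun φ A A' => ?_⟩
  have hd : 0 ≤ decaySeminorm k φ := by unfold decaySeminorm; positivity
  have h1 := (enorm_integral_le_lintegral_enorm _).trans (h φ A A')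
  rw [← ofReal_norm] at h1
  exact (ENNReal.ofReal_le_ofReal_iff (by positivity)).1 h1

lemma ae_torusProj {p : UnitAddTorus ι → Prop} (h : ∀ᵐ y, p y) : ∀ᵐ z, p (torusProj B z) :=
  (quasiMeasurePreserving_torusProj B).ae h

/-- The functional `A ↦ ∫ A A' φ`, where `A`, `A'` are regarded as periodic functions. -/
def torusPairing (φ : 𝓢(Phase d, ℂ)) (A' : TorusL2 ι) : TorusL2 ι →L[ℂ] ℂ :=
  LinearMap.mkContinuousOfExistsBound
    { toFun := fun A => ∫ z, A (torusProj B z) * A' (torusProj B z) * φ z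
      map_add' := fun A₁ A₂ => by
        rw [← integral_add (integrable_torus_mul B φ A₁ A') (integrable_torus_mul B φ A₂ A')]
        refine integral_congr_ae ?_
        filter_upwards [ae_torusProj B (Lp.coeFn_add A₁ A₂)] with z h
        rw [h, Pi.add_apply]; ring
      map_smul' := fun c A => by
        rw [RingHom.id_apply, ← integral_smul]
        refine integral_congr_ae ?_
        filter_upwards [ae_torusProj B (Lp.coeFn_smul c A)] with z h
        rw [h, Pi.smul_apply, smul_eq_mul, smul_eq_mul]; ring }
    (by
      obtain ⟨k, C, hC, h⟩ := exists_integral_bound B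
      exact ⟨C * decaySeminorm k φ * ‖A'‖, fun A => (h φ A A').trans (le_of_eq (by ring))⟩)

lemma torusPairing_apply (φ : 𝓢(Phase d, ℂ)) (A A' : TorusL2 ι) :
    torusPairing B φ A' A = ∫ z, A (torusProj B z) * A' (torusProj B z) * φ z := rfl

/-- The pairing is continuous in A for the L² norm, so the Fourier series of A may be integrated
term by term. -/
lemma hasSum_torusPairing (φ : 𝓢(Phase d, ℂ)) (A A' : TorusL2 ι) :
    HasSum (fun m : adjointLattice (latticeOf B) =>
      UnitAddTorus.mFourierCoeff A (adjointEquiv B m) *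
        ∫ z, Complex.exp (2 * Real.pi * Complex.I * (sympl m z : ℝ)) * A' (torusProj B z) * φ z)
      (∫ z, A (torusProj B z) * A' (torusProj B z) * φ z) := by
  have h := (torusPairing B φ A').hasSum (UnitAddTorus.hasSum_mFourier_series_L2 A)
  rw [← (adjointEquiv B).hasSum_iff, torusPairing_apply] at h
  refine h.congr_fun fun m => ?_
  rw [Function.comp_apply, map_smul, smul_eq_mul, torusPairing_apply]
  congr 1
  refine integral_congr_ae ?_
  filter_upwards [ae_torusProj B (UnitAddTorus.coeFn_mFourierLp 2 (adjointEquiv B m))] with z hz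
  rw [hz, mFourier_torusProj]

lemma hasSum_torusPairing_exp (φ : 𝓢(Phase d, ℂ)) (A : TorusL2 ι)
    (m : adjointLattice (latticeOf B)) :
    HasSum (fun m' : adjointLattice (latticeOf B) =>
      UnitAddTorus.mFourierCoeff A (adjointEquiv B m') *
        ∫ z, Complex.exp (2 * Real.pi * Complex.I * (sympl (m + m') z : ℝ)) * φ z)
      (∫ z, Complex.exp (2 * Real.pi * Complex.I * (sympl m z : ℝ)) * A (torusProj B z) * φ z) := by
  have h := hasSum_torusPairing B φ A (UnitAddTorus.mFourierLp 2 (adjointEquiv B m))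
  have hm := ae_torusProj B (UnitAddTorus.coeFn_mFourierLp 2 (adjointEquiv B m))
  have e : ∫ z, A (torusProj B z) *
      (UnitAddTorus.mFourierLp 2 (adjointEquiv B m) : TorusL2 ι) (torusProj B z) * φ z =
      ∫ z, Complex.exp (2 * Real.pi * Complex.I * (sympl m z : ℝ)) * A (torusProj B z) * φ z := by
    refine integral_congr_ae ?_
    filter_upwards [hm] with z hz
    rw [hz, mFourier_torusProj, mul_comm (A _)]
  rw [e] at h
  refine h.congr_fun fun m' => ?_
  congr 1
  refine integral_congr_ae ?_
  filter_upwards [hm] with z hz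
  rw [hz, mFourier_torusProj, ← Complex.exp_add]
  congr 2
  rw [AddSubgroup.coe_add, sympl_add_left]
  push_cast; ring

/-- Setting the second factor equal to the constant 1 deduces statements about one periodic function
from those about two. -/
lemma mFourierLp_zero_torusProj :
    ∀ᵐ z, (UnitAddTorus.mFourierLp 2 0 : TorusL2 ι) (torusProj B z) = 1 := by
  filter_upwards [ae_torusProj B (UnitAddTorus.coeFn_mFourierLp 2 (0 : ι → ℤ))] with z hz
  rw [hz, UnitAddTorus.mFourier_zero]; rfl

lemma integrable_torus (φ : 𝓢(Phase d, ℂ)) (A : TorusL2 ι) :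
    Integrable fun z => A (torusProj B z) * φ z := by
  refine (integrable_torus_mul B φ A (UnitAddTorus.mFourierLp 2 0)).congr ?_
  filter_upwards [mFourierLp_zero_torusProj B] with z hz
  rw [hz, mul_one]

lemma hasSum_integral_torus (φ : 𝓢(Phase d, ℂ)) (A : TorusL2 ι) :
    HasSum (fun m : adjointLattice (latticeOf B) =>
      UnitAddTorus.mFourierCoeff A (adjointEquiv B m) *
        ∫ z, Complex.exp (2 * Real.pi * Complex.I * (sympl m z : ℝ)) * φ z)
      (∫ z, A (torusProj B z) * φ z) := by
  have h := hasSum_torusPairing_exp B φ A 0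
  have e : ∀ z : Phase d, Complex.exp (2 * Real.pi * Complex.I *
      (sympl ((0 : adjointLattice (latticeOf B)) : Phase d) z : ℝ)) = 1 := fun z => by
    simp [sympl]
  simp only [e, one_mul] at h
  simpa only [AddSubgroup.coe_zero, zero_add] using h

lemma exists_isGivenBy_mul (A A' : TorusL2 ι) : ∃ u : 𝓢'(Phase d, ℂ),
    IsGivenBy u fun z => A (torusProj B z) * A' (torusProj B z) := by
  obtain ⟨k, C, hC, h⟩ := exists_integral_bound B
  obtain ⟨u, hu⟩ := exists_temperedDistribution
    (fun φ => ∫ z, A (torusProj B z) * A' (torusProj B z) * φ z)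
    (fun φ ψ => by
      rw [← integral_add (integrable_torus_mul B φ A A') (integrable_torus_mul B ψ A A')]
      simp only [add_apply, mul_add])
    (fun c φ => by
      rw [← integral_const_mul]
      simp only [smul_apply, smul_eq_mul, mul_left_comm])
    k (C := C * (‖A‖ * ‖A'‖)) (by positivity) (fun φ => (h φ A A').trans (le_of_eq (by ring)))
  exact ⟨u, fun φ => ⟨integrable_torus_mul B φ A A', hu φ⟩⟩

lemma exists_isGivenBy (A : TorusL2 ι) : ∃ u : 𝓢'(Phase d, ℂ),
    IsGivenBy u fun z => A (torusProj B z) := by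
  obtain ⟨u, hu⟩ := exists_isGivenBy_mul B A (UnitAddTorus.mFourierLp 2 0)
  refine ⟨u, fun φ => ⟨integrable_torus B φ A, ?_⟩⟩
  rw [(hu φ).2]
  refine integral_congr_ae ?_
  filter_upwards [mFourierLp_zero_torusProj B] with z hz
  rw [hz, mul_one]

end ModInv

end

noncomputable section

namespace ModInv

attribute [local instance] instMeasureSpaceUnitAddCircle

variable {d : ℕ}

/-! ### Operations on distributions given by functions -/

/-- The Schwartz function `z ↦ φ (-z)`. -/
def negCLM (d : ℕ) : 𝓢(Phase d, ℂ) →L[ℂ] 𝓢(Phase d, ℂ) :=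
  compCLMOfContinuousLinearEquiv ℂ (ContinuousLinearEquiv.neg ℝ)

lemma negCLM_apply (φ : 𝓢(Phase d, ℂ)) (z : Phase d) : negCLM d φ z = φ (-z) := rfl

lemma IsGivenBy.congr {u : 𝓢'(Phase d, ℂ)} {a b : Phase d → ℂ} (h : IsGivenBy u a)
    (hab : a =ᵐ[volume] b) : IsGivenBy u b := fun φ => by
  have e : (fun z => a z * φ z) =ᵐ[volume] fun z => b z * φ z := by
    filter_upwards [hab] with z hz
    rw [hz]
  exact ⟨(h φ).1.congr e, (h φ).2.trans (integral_congr_ae e)⟩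

instance : (volume : Measure (Phase d)).IsNegInvariant :=
  ⟨((Measure.measurePreserving_neg (volume : Measure (Pos d))).prod
    (Measure.measurePreserving_neg (volume : Measure (Pos d)))).map_eq⟩

lemma IsGivenBy.exists_neg {u : 𝓢'(Phase d, ℂ)} {a : Phase d → ℂ} (h : IsGivenBy u a) :
    ∃ v : 𝓢'(Phase d, ℂ), IsGivenBy v fun z => a (-z) := by
  refine ⟨PointwiseConvergenceCLM.precomp ℂ (negCLM d) u, fun φ => ?_⟩
  have h1 := h (negCLM d φ)
  have e : (fun z => a (-z) * φ z) = fun z => (fun w => a w * negCLM d φ w) (-z) := by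
    ext z; simp [negCLM_apply]
  rw [e]
  refine ⟨h1.1.comp_neg, ?_⟩
  rw [integral_neg_eq_self (fun w => a w * negCLM d φ w) volume]
  exact h1.2

lemma finrank_phase : Module.finrank ℝ (Phase d) = 2 * d := by
  rw [Module.finrank_prod, finrank_euclideanSpace_fin, two_mul]

lemma integral_comp_two_smul (F : Phase d → ℂ) :
    ∫ w, F w = 2 ^ (2 * d) * ∫ z, F ((2 : ℝ) • z) := by
  rw [Measure.integral_comp_smul, finrank_phase, abs_of_nonneg (by positivity), Complex.real_smul]
  push_cast
  rw [mul_inv_cancel_left₀ (pow_ne_zero _ two_ne_zero)]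

lemma halve_double (φ : 𝓢(Phase d, ℂ)) : double (halve φ) = φ := by
  ext z
  rw [double_apply, halve_apply, smul_smul, inv_mul_cancel₀ two_ne_zero, one_smul]

/-- The second description of v, with the dilation moved to the test function, is the one used to
identify v as a Weyl symbol. -/
lemma IsGivenBy.exists_double {u : 𝓢'(Phase d, ℂ)} {a : Phase d → ℂ} (h : IsGivenBy u a) :
    ∃ v : 𝓢'(Phase d, ℂ), IsGivenBy v (fun z => 2 ^ (2 * d) * a ((2 : ℝ) • z)) ∧
      ∀ φ, v φ = ∫ z, a z * halve φ z := by
  have hv : ∀ φ : 𝓢(Phase d, ℂ), PointwiseConvergenceCLM.precomp ℂ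
      (compCLMOfContinuousLinearEquiv ℂ
        (ContinuousLinearEquiv.smulLeft (Units.mk0 (2⁻¹ : ℝ) (by norm_num)))) u φ =
      ∫ z, a z * halve φ z := fun φ => (h (halve φ)).2
  refine ⟨_, fun φ => ?_, hv⟩
  have h1 := (h (halve φ)).1.comp_smul (two_ne_zero (α := ℝ))
  have e : (fun z => 2 ^ (2 * d) * a ((2 : ℝ) • z) * φ z) =
      fun z => 2 ^ (2 * d) * (fun w => a w * halve φ w) ((2 : ℝ) • z) := by
    ext z
    simp only [halve_apply, smul_smul, inv_mul_cancel₀ (two_ne_zero (α := ℝ)), one_smul]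
    ring
  rw [hv, e]
  refine ⟨h1.const_mul _, ?_⟩
  rw [integral_const_mul, integral_comp_two_smul]

/-! ### Symbols of modulation invariant operators -/

variable {ι : Type} [Fintype ι] {B : Module.Basis ι ℝ (Phase d)}

/-- The coefficients of the Weyl symbol of `S`, in terms of the expansion of `S P`. -/
def symbolCoeff {Λ : Submodule ℤ (Phase d)} (r : adjointLattice Λ → ℂ) (m : adjointLattice Λ) : ℂ :=
  (2 ^ d)⁻¹ * r m

lemma summable_sq_symbolCoeff {Λ : Submodule ℤ (Phase d)} {r : adjointLattice Λ → ℂ}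
    (hr : Summable fun m => ‖r m‖ ^ 2) : Summable fun m => ‖symbolCoeff r m‖ ^ 2 := by
  simp only [symbolCoeff, norm_mul, mul_pow]
  exact hr.mul_left _

lemma conj_wigner_eq_shiftCoeff (f g : 𝓢(Pos d, ℂ)) (z : Phase d) :
    conj (wigner g f z) = 2 ^ d * shiftCoeff (parity d (f.toLp 2)) (g.toLp 2) z :=
  conj_wigner g f z

lemma HasExpansion.hasSum_symbolCoeff {Λ : Submodule ℤ (Phase d)} {S : L2 d →L[ℂ] L2 d}
    {r : adjointLattice Λ → ℂ} (hR : HasExpansion Λ (S ∘L parity d) r) (F G : L2 d)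
    (hG : ∀ H, Summable fun m : adjointLattice Λ => ‖⟪G, rho ((2 : ℝ) • (m : Phase d)) H⟫_ℂ‖ ^ 2) :
    HasSum (fun m : adjointLattice Λ => symbolCoeff r m * (2 ^ d * shiftCoeff (parity d F) G m))
      ⟪G, S F⟫_ℂ := by
  have h := hR.2 (parity d F) G (hG _)
  rw [ContinuousLinearMap.comp_apply, parity_parity] at h
  refine h.congr_fun fun m => ?_
  rw [symbolCoeff, shiftCoeff]
  have : (2 ^ d : ℂ) ≠ 0 := pow_ne_zero _ two_ne_zero
  field_simp

lemma HasExpansion.hasSum_wigner {S : L2 d →L[ℂ] L2 d} {r : adjointLattice (latticeOf B) → ℂ}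
    (hR : HasExpansion (latticeOf B) (S ∘L parity d) r) (f g : 𝓢(Pos d, ℂ)) :
    HasSum (fun m : adjointLattice (latticeOf B) => symbolCoeff r m * conj (wigner g f m))
      ⟪g.toLp 2, S (f.toLp 2)⟫_ℂ :=
  (hR.hasSum_symbolCoeff _ _ fun H => summable_sq_inner_schwartz_rho B H g).congr_fun fun m =>
    congrArg (symbolCoeff r m * ·) (conj_wigner_eq_shiftCoeff f g m)

lemma HasExpansion.exists_weylSymbol {S : L2 d →L[ℂ] L2 d} {r : adjointLattice (latticeOf B) → ℂ}
    (hR : HasExpansion (latticeOf B) (S ∘L parity d) r) : ∃ σ : 𝓢'(Phase d, ℂ), IsWeylSymbol S σ ∧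
      IsDiracSeries (fun m : adjointLattice (latticeOf B) => (m : Phase d)) (symbolCoeff r) σ := by
  obtain ⟨k, hk⟩ := summable_adjointLattice_decay B
  have hc := summable_sq_symbolCoeff hR.1
  obtain ⟨σ, hσ⟩ := exists_isDiracSeries (fun m : adjointLattice (latticeOf B) => (m : Phase d))
    (symbolCoeff r) k (by
      refine Summable.of_nonneg_of_le (fun _ => by positivity) (fun m => ?_) (hc.add hk)
      have h1 : (1 + ‖(m : Phase d)‖)⁻¹ ^ k ≤ 1 :=
        pow_le_one₀ (by positivity) (inv_le_one_of_one_le₀ (by linarith [norm_nonneg (m : Phase d)]))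
      have h0 : 0 ≤ (1 + ‖(m : Phase d)‖)⁻¹ ^ k := by positivity
      -- For a weight w ∈ [0, 1], |c|w ≤ |c|² + w; so square summable coefficients already give a
      -- tempered series.
      nlinarith [sq_nonneg (‖symbolCoeff r m‖ - (1 + ‖(m : Phase d)‖)⁻¹ ^ k),
        sq_nonneg ‖symbolCoeff r m‖, mul_nonneg h0 (sub_nonneg.2 h1)])
  exact ⟨σ, fun f g => (hR.hasSum_wigner f g).unique (hσ (conjS (wigner g f))), hσ⟩

lemma opCheck_parity (T : L2 d →L[ℂ] L2 d) (S : L2 d →L[ℂ] L2 d) :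
    (S ∘L parity d) ∘L opCheck (T ∘L parity d) = S ∘L T := by
  ext1 F
  simp only [opCheck, ContinuousLinearMap.comp_apply, parity_parity]

/-- The composition formula for SP and P(TP)P, whose product is ST, with coefficients rewritten as
symbol masses. The factor 2^(2d) undoes the two normalizations 2^(-d). -/
lemma HasExpansion.hasSum_symbolCoeff_mul {S T : L2 d →L[ℂ] L2 d}
    {r t : adjointLattice (latticeOf B) → ℂ}
    (hΛ : ∀ z ∈ adjointLattice (latticeOf B), ∀ w ∈ adjointLattice (latticeOf B),
      ∃ n : ℤ, 2 * sympl z w = n)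
    (hR : HasExpansion (latticeOf B) (S ∘L parity d) r)
    (hQ : HasExpansion (latticeOf B) (T ∘L parity d) t) (f g : 𝓢(Pos d, ℂ)) :
    HasSum (fun p : adjointLattice (latticeOf B) × adjointLattice (latticeOf B) =>
      symbolCoeff r p.1 * symbolCoeff t (-p.2) * (2 ^ (2 * d) *
        double (conjS (ambiguity g f)) (p.1 + p.2 : adjointLattice (latticeOf B))))
      ⟪g.toLp 2, (S ∘L T) (f.toLp 2)⟫_ℂ := by
  have h := hR.hasSum_comp hΛ hQ.opCheck f g
  rw [← ContinuousLinearMap.comp_apply, opCheck_parity] at h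
  refine h.congr_fun fun p => ?_
  have : (2 ^ d : ℂ) ≠ 0 := pow_ne_zero _ two_ne_zero
  rw [← shiftCoeff_schwartz, symbolCoeff, symbolCoeff, two_mul d, pow_add]
  field_simp

end ModInv

end

noncomputable section

namespace ModInv

attribute [local instance] instMeasureSpaceUnitAddCircle

variable {d : ℕ}

/-! ### Discrete convolutions -/

/-- Regroups the double series by the value of l + m. -/
lemma IsDiracConvolution.hasSum_fiber {L : AddSubgroup (Phase d)} {a b : L → ℂ}
    {u : 𝓢'(Phase d, ℂ)} (h : IsDiracConvolution L a b u)
    (hs : ∀ g, Summable fun l => a l * b (g - l)) (φ : 𝓢(Phase d, ℂ)) :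
    HasSum (fun g : L => (∑' l, a l * b (g - l)) * φ g) (u φ) := by
  let s : L × L ≃ L × L :=
    { toFun := fun p => (p.2, p.1 - p.2)
      invFun := fun p => (p.1 + p.2, p.1)
      left_inv := fun p => by simp
      right_inv := fun p => by simp }
  refine (s.hasSum_iff.2 (h φ)).prod_fiberwise fun g => ?_
  refine ((hs g).hasSum.mul_right (φ g)).congr_fun fun l => ?_
  simp [s]

lemma exists_isDiracConvolution {ι : Type} [Fintype ι] (B : Module.Basis ι ℝ (Phase d))
    {a b : adjointLattice (latticeOf B) → ℂ} (ha : Summable fun m => ‖a m‖ ^ 2)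
    (hb : Summable fun m => ‖b m‖ ^ 2) :
    ∃ u, IsDiracConvolution (adjointLattice (latticeOf B)) a b u := by
  obtain ⟨k, hk⟩ := summable_adjointLattice_decay B
  have h := summable_mul_mul_add ha hb
    (k := fun m : adjointLattice (latticeOf B) => (((1 + ‖(m : Phase d)‖)⁻¹ ^ k : ℝ) : ℂ))
    (by simpa only [Complex.norm_real] using hk.norm)
  refine exists_isDiracSeries _ _ k (h.norm.congr fun p => ?_)
  have h0 : 0 ≤ (1 + ‖(p.1 : Phase d) + (p.2 : Phase d)‖)⁻¹ ^ k := by positivity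
  rw [norm_mul, Complex.norm_real, AddSubgroup.coe_add, Real.norm_of_nonneg h0]

lemma exists_dilate (u : 𝓢'(Phase d, ℂ)) :
    ∃ v : 𝓢'(Phase d, ℂ), ∀ φ, v φ = 2 ^ (2 * d) * u (double φ) :=
  ⟨(2 ^ (2 * d) : ℂ) • PointwiseConvergenceCLM.precomp ℂ (compCLMOfContinuousLinearEquiv ℂ
    (ContinuousLinearEquiv.smulLeft (Units.mk0 (2 : ℝ) (by norm_num)))) u, fun _ => rfl⟩

/-! ### Symplectic Fourier integrals of Wigner and ambiguity functions -/

lemma conjS_apply (φ : 𝓢(Phase d, ℂ)) (z : Phase d) : conjS φ z = conj (φ z) := rfl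

lemma integral_exp_conjS (φ : 𝓢(Phase d, ℂ)) (m : Phase d) :
    ∫ z, Complex.exp (2 * Real.pi * Complex.I * (sympl m z : ℝ)) * conjS φ z =
      conj (∫ z, φ z * Complex.exp (-(2 * Real.pi * Complex.I * (sympl m z : ℝ)))) := by
  rw [← integral_conj]
  refine integral_congr_ae (.of_forall fun z => ?_)
  simp only [conjS_apply, map_mul, ← Complex.exp_conj, map_neg, Complex.conj_ofReal,
    Complex.conj_I, map_ofNat]
  rw [mul_comm]
  congr 2
  ring

lemma integral_exp_conj_ambiguity (f g : 𝓢(Pos d, ℂ)) (m : Phase d) :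
    ∫ z, Complex.exp (2 * Real.pi * Complex.I * (sympl m z : ℝ)) * conjS (ambiguity g f) z =
      conj (wigner g f m) := by
  rw [integral_exp_conjS, sympl_fourier_ambiguity]

/-- The substitution z ↦ 2z in dimension 2d gives the factor, and Ω(m, 2z) = Ω(2m, z) moves the
dilation to the frequency, where the symplectic transform of W is A. -/
lemma integral_exp_halve_conj_wigner (f g : 𝓢(Pos d, ℂ)) (m : Phase d) :
    ∫ z, Complex.exp (2 * Real.pi * Complex.I * (sympl m z : ℝ)) * halve (conjS (wigner g f)) z =
      2 ^ (2 * d) * double (conjS (ambiguity g f)) m := by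
  rw [integral_comp_two_smul, double_apply, conjS_apply, ← sympl_fourier_wigner,
    ← integral_exp_conjS]
  congr 1
  refine integral_congr_ae (.of_forall fun z => ?_)
  simp only [halve_apply, smul_smul, inv_mul_cancel₀ (two_ne_zero (α := ℝ)), one_smul,
    sympl_smul_left, sympl_smul_right]

lemma ambiguity_neg (f g : 𝓢(Pos d, ℂ)) (z : Phase d) :
    ambiguity f g (-z) = conj (ambiguity g f z) := by
  rw [conj_ambiguity, ambiguity_eq_inner, inner_rho_left, neg_neg]

/-- Follows from A(f,g)(-z) = conj A(g,f)(z) after the substitution z ↦ -z. -/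
lemma IsFourierWigner.adjoint {T : L2 d →L[ℂ] L2 d} {u v : 𝓢'(Phase d, ℂ)} {b : Phase d → ℂ}
    (h : IsFourierWigner T u) (hu : IsGivenBy u b) (hv : IsGivenBy v fun z => conj (b (-z))) :
    IsFourierWigner (ContinuousLinearMap.adjoint T) v := fun f g => by
  rw [ContinuousLinearMap.adjoint_inner_right, ← inner_conj_symm, h g f, bracket, bracket,
    (hu _).2, (hv _).2, ← integral_conj, ← integral_neg_eq_self]
  refine integral_congr_ae (.of_forall fun z => ?_)
  simp only [map_mul, conjS_apply, ambiguity_neg, Complex.conj_conj]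

/-! ### The spreading function and the symbol of a product as periodic functions -/

variable {ι : Type} [Fintype ι] {B : Module.Basis ι ℝ (Phase d)}

lemma exists_torusL2 {c : adjointLattice (latticeOf B) → ℂ} (hc : Summable fun m => ‖c m‖ ^ 2) :
    ∃ A : TorusL2 ι, ∀ m, UnitAddTorus.mFourierCoeff A (adjointEquiv B m) = c m := by
  obtain ⟨A, hA⟩ := exists_torusL2_of_coeff (fun n => c ((adjointEquiv B).symm n))
    ((adjointEquiv B).symm.summable_iff (f := fun m => ‖c m‖ ^ 2) |>.2 hc)
  exact ⟨A, fun m => by rw [hA, Equiv.symm_apply_apply]⟩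

/-- Parseval: W(g,f)(m) is the symplectic Fourier integral of A(g,f), so pairing the symbol with W
equals pairing the periodic function with A. -/
lemma HasExpansion.isFourierWigner {S : L2 d →L[ℂ] L2 d} {r : adjointLattice (latticeOf B) → ℂ}
    (hR : HasExpansion (latticeOf B) (S ∘L parity d) r) {A : TorusL2 ι}
    (hA : ∀ m, UnitAddTorus.mFourierCoeff A (adjointEquiv B m) = symbolCoeff r m)
    {u : 𝓢'(Phase d, ℂ)} (hu : IsGivenBy u fun z => A (torusProj B z)) : IsFourierWigner S u :=
  fun f g => by
    have h := hasSum_integral_torus B (conjS (ambiguity g f)) A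
    simp only [integral_exp_conj_ambiguity, hA] at h
    exact ((hR.hasSum_wigner f g).unique h).trans (hu _).2.symm

/-- Variant with reflected coefficients and reflected argument. It lets one function serve both as z
↦ F_W(T)(-z) and as a factor of the symbol, so that the final identity holds pointwise. -/
lemma HasExpansion.isFourierWigner_neg {S : L2 d →L[ℂ] L2 d}
    {r : adjointLattice (latticeOf B) → ℂ}
    (hR : HasExpansion (latticeOf B) (S ∘L parity d) r) {A : TorusL2 ι}
    (hA : ∀ m, UnitAddTorus.mFourierCoeff A (adjointEquiv B m) = symbolCoeff r (-m))
    {u : 𝓢'(Phase d, ℂ)} (hu : IsGivenBy u fun z => A (torusProj B (-z))) : IsFourierWigner S u :=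
  fun f g => by
    have h := (Equiv.neg _).hasSum_iff.2
      (hasSum_integral_torus B (negCLM d (conjS (ambiguity g f))) A)
    have e : ∫ z, A (torusProj B z) * negCLM d (conjS (ambiguity g f)) z =
        bracket u (ambiguity g f) := by
      rw [bracket, (hu _).2, ← integral_neg_eq_self]
      simp only [negCLM_apply, neg_neg]
    rw [e] at h
    refine (hR.hasSum_wigner f g).unique (h.congr_fun fun m => ?_)
    rw [Function.comp_apply, Equiv.neg_apply, hA, neg_neg, ← integral_exp_conj_ambiguity,
      ← integral_neg_eq_self]
    simp only [negCLM_apply, AddSubgroup.coe_neg, sympl_neg_left, sympl_neg_right]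

lemma HasExpansion.isWeylSymbol_comp {S T : L2 d →L[ℂ] L2 d}
    {r t : adjointLattice (latticeOf B) → ℂ}
    (hΛ : ∀ z ∈ adjointLattice (latticeOf B), ∀ w ∈ adjointLattice (latticeOf B),
      ∃ n : ℤ, 2 * sympl z w = n)
    (hR : HasExpansion (latticeOf B) (S ∘L parity d) r)
    (hQ : HasExpansion (latticeOf B) (T ∘L parity d) t) {A A' : TorusL2 ι}
    (hA : ∀ m, UnitAddTorus.mFourierCoeff A (adjointEquiv B m) = symbolCoeff r m)
    (hA' : ∀ m, UnitAddTorus.mFourierCoeff A' (adjointEquiv B m) = symbolCoeff t (-m))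
    {v : 𝓢'(Phase d, ℂ)}
    (hv : ∀ φ, v φ = ∫ z, A (torusProj B z) * A' (torusProj B z) * halve φ z) :
    IsWeylSymbol (S ∘L T) v := fun f g => by
  have h1 := hasSum_torusPairing B (halve (conjS (wigner g f))) A A'
  have h2 := hasSum_torusPairing_exp B (halve (conjS (wigner g f))) A'
  simp only [integral_exp_halve_conj_wigner, hA, hA'] at h1 h2
  -- Expanding A and then A' gives the iterated form of the absolutely convergent double series for
  -- ⟨STf, g⟩.
  have h3 := (hR.hasSum_symbolCoeff_mul hΛ hQ f g).prod_fiberwise fun m =>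
    ((h2 m).mul_left (symbolCoeff r m)).congr_fun fun m' => by rw [mul_assoc]
  rw [bracket, hv]
  exact h3.unique h1

/-! ### The three assertions for the lattice of a basis. -/

theorem spreading_function_calculus (S T : L2 d →L[ℂ] L2 d)
    (hS : IsModulationInvariant (latticeOf B) S) (hT : IsModulationInvariant (latticeOf B) T)
    (hΛ : ∀ z ∈ adjointLattice (latticeOf B), ∀ w ∈ adjointLattice (latticeOf B),
      ∃ n : ℤ, 2 * sympl z w = n) :
    (∃ (σS σT FST conv : 𝓢'(Phase d, ℂ)) (c e : adjointLattice (latticeOf B) → ℂ),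
      IsWeylSymbol S σS ∧ IsWeylSymbol T σT ∧ IsFourierWigner (S ∘L T) FST ∧
      IsDiracSeries (fun l : adjointLattice (latticeOf B) => (l : Phase d)) c σS ∧
      IsDiracSeries (fun m : adjointLattice (latticeOf B) => (m : Phase d)) e σT ∧
      IsDiracConvolution (adjointLattice (latticeOf B)) c (fun m => e (-m)) conv ∧
      (∀ g : adjointLattice (latticeOf B), Summable fun l => c l * e (l - g)) ∧
      IsDiracSeries (fun g : adjointLattice (latticeOf B) => (2 : ℝ) • (g : Phase d))
        (fun g => 2 ^ (2 * d) * ∑' l, c l * e (l - g)) FST ∧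
      ∀ φ : 𝓢(Phase d, ℂ), FST (halve φ) = 2 ^ (2 * d) * conv φ) ∧
    S ∘L opCheck T = T ∘L opCheck S ∧
    (∃ (σST FS FT FT' : 𝓢'(Phase d, ℂ)) (h a b : Phase d → ℂ),
      IsWeylSymbol (S ∘L T) σST ∧ IsFourierWigner S FS ∧ IsFourierWigner T FT ∧
      IsFourierWigner (ContinuousLinearMap.adjoint T) FT' ∧
      IsGivenBy σST h ∧ IsGivenBy FS a ∧ IsGivenBy FT b ∧
      IsGivenBy FT' (fun z => conj (b (-z))) ∧
      ∀ z, h ((2⁻¹ : ℝ) • z) = 2 ^ (2 * d) * (a z * b (-z))) := by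
  obtain ⟨r, hR⟩ := exists_hasExpansion hS.commutesWithHalf
  obtain ⟨t, hQ⟩ := exists_hasExpansion hT.commutesWithHalf
  have hr := summable_sq_symbolCoeff hR.1
  have ht := summable_sq_symbolCoeff hQ.1
  have ht' : Summable fun m => ‖symbolCoeff t (-m)‖ ^ 2 :=
    (Equiv.neg _).summable_iff (f := fun m => ‖symbolCoeff t m‖ ^ 2) |>.2 ht
  refine ⟨?_, ?_, ?_⟩
  · obtain ⟨σS, hσS, hcS⟩ := hR.exists_weylSymbol
    obtain ⟨σT, hσT, hcT⟩ := hQ.exists_weylSymbol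
    obtain ⟨conv, hconv⟩ := exists_isDiracConvolution B hr ht'
    obtain ⟨FST, hFST⟩ := exists_dilate conv
    have hs : ∀ g : adjointLattice (latticeOf B),
        Summable fun l => symbolCoeff r l * symbolCoeff t (l - g) := fun g =>
      summable_mul_of_sq hr
        ((Equiv.subRight g).summable_iff (f := fun m => ‖symbolCoeff t m‖ ^ 2) |>.2 ht)
    refine ⟨σS, σT, FST, conv, symbolCoeff r, symbolCoeff t, hσS, hσT, fun f g => ?_, hcS, hcT,
      hconv, hs, fun φ => ?_, fun φ => ?_⟩
    · rw [bracket, hFST]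
      refine (hR.hasSum_symbolCoeff_mul hΛ hQ f g).unique
        (((hconv (double (conjS (ambiguity g f)))).mul_left (2 ^ (2 * d))).congr_fun fun p => ?_)
      rw [AddSubgroup.coe_add]
      ring
    · have h := (hconv.hasSum_fiber (fun g => by simpa only [neg_sub] using hs g)
        (double φ)).mul_left (2 ^ (2 * d))
      simpa only [neg_sub, hFST, double_apply, mul_assoc] using h
    · rw [hFST, halve_double]
  · have h := hR.comm hΛ hQ
    ext1 F
    have h' := congrArg (· F) h
    simpa only [opCheck, ContinuousLinearMap.comp_apply, parity_parity] using h'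
  -- A has the coefficients c_m of σ_S and represents F_W(S); A' has the coefficients e_{-m} of the
  -- reflected σ_T and represents z ↦ F_W(T)(-z).
  · obtain ⟨A, hA⟩ := exists_torusL2 hr
    obtain ⟨A', hA'⟩ := exists_torusL2 ht'
    obtain ⟨u, hu⟩ := exists_isGivenBy_mul B A A'
    obtain ⟨σST, hσ, hσ'⟩ := hu.exists_double
    obtain ⟨FS, hFS⟩ := exists_isGivenBy B A
    obtain ⟨FT₀, hFT₀⟩ := exists_isGivenBy B A'
    obtain ⟨FT, hFT⟩ := hFT₀.exists_neg
    -- F_W(T*)(z) is the conjugate of F_W(T)(-z), hence of A'.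
    obtain ⟨FT', hFT'⟩ := exists_isGivenBy B (star A')
    have hT' : IsGivenBy FT' fun z => conj (A' (torusProj B (- -z))) := by
      refine hFT'.congr ?_
      filter_upwards [ae_torusProj B (Lp.coeFn_star A')] with z hz
      rw [hz, neg_neg]; rfl
    have hFTW := hQ.isFourierWigner_neg hA' hFT
    refine ⟨σST, FS, FT, FT', _, _, _, hR.isWeylSymbol_comp hΛ hQ hA hA' hσ',
      hR.isFourierWigner hA hFS, hFTW, hFTW.adjoint hFT hT', hσ, hFS, hFT, hT', fun z => ?_⟩
    simp only [smul_smul, mul_inv_cancel₀ (two_ne_zero (α := ℝ)), one_smul, neg_neg]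

end ModInv

end

theorem theorem6p1 (d : ℕ) (Λ : Submodule ℤ (ModInv.Phase d)) [DiscreteTopology Λ]
    [IsZLattice ℝ Λ] (S T : ModInv.L2 d →L[ℂ] ModInv.L2 d)
    (hS : ModInv.IsModulationInvariant Λ S) (hT : ModInv.IsModulationInvariant Λ T)
    (hΛ : ∀ z ∈ ModInv.adjointLattice Λ, ∀ w ∈ ModInv.adjointLattice Λ,
      ∃ n : ℤ, 2 * ModInv.sympl z w = n) :
    -- the spreading function calculus `F_W(ST)(2z) = 2^(2d) (σ_S * σ̌_T)(z)`
    (∃ (σS σT FST conv : 𝓢'(ModInv.Phase d, ℂ)) (c e : ModInv.adjointLattice Λ → ℂ),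
      ModInv.IsWeylSymbol S σS ∧ ModInv.IsWeylSymbol T σT ∧
      ModInv.IsFourierWigner (S ∘L T) FST ∧
      -- `σ_S = ∑ c_l δ_l`, `σ_T = ∑ e_m δ_m`, hence `σ̌_T = ∑ e_{-m} δ_m`
      ModInv.IsDiracSeries (fun l : ModInv.adjointLattice Λ => (l : ModInv.Phase d)) c σS ∧
      ModInv.IsDiracSeries (fun m : ModInv.adjointLattice Λ => (m : ModInv.Phase d)) e σT ∧
      -- `conv = σ_S * σ̌_T`
      ModInv.IsDiracConvolution (ModInv.adjointLattice Λ) c (fun m => e (-m)) conv ∧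
      -- the mass of `F_W(ST)` at `2g` is `2^(2d)` times the mass of `σ_S * σ̌_T` at `g`
      (∀ g : ModInv.adjointLattice Λ, Summable fun l => c l * e (l - g)) ∧
      ModInv.IsDiracSeries (fun g : ModInv.adjointLattice Λ => (2 : ℝ) • (g : ModInv.Phase d))
        (fun g => 2 ^ (2 * d) * ∑' l, c l * e (l - g)) FST ∧
      -- the same identity, between the distributions themselves
      ∀ φ : 𝓢(ModInv.Phase d, ℂ), FST (ModInv.halve φ) = 2 ^ (2 * d) * conv φ) ∧
    -- `S Ť = T Š`
    S ∘L ModInv.opCheck T = T ∘L ModInv.opCheck S ∧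
    -- `σ_{ST}(z / 2) = 2^(2d) F_W(S)(z) F_W(T)(-z)`, where `F_W(T)(-z) = conj (F_W(T*)(z))`
    (∃ (σST FS FT FT' : 𝓢'(ModInv.Phase d, ℂ)) (h a b : ModInv.Phase d → ℂ),
      ModInv.IsWeylSymbol (S ∘L T) σST ∧ ModInv.IsFourierWigner S FS ∧
      ModInv.IsFourierWigner T FT ∧
      ModInv.IsFourierWigner (ContinuousLinearMap.adjoint T) FT' ∧
      ModInv.IsGivenBy σST h ∧ ModInv.IsGivenBy FS a ∧ ModInv.IsGivenBy FT b ∧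
      ModInv.IsGivenBy FT' (fun z => conj (b (-z))) ∧
      ∀ z, h ((2⁻¹ : ℝ) • z) = 2 ^ (2 * d) * (a z * b (-z))) := by
  have : Module.Finite ℤ Λ := ZLattice.module_finite ℝ Λ
  have : Module.Free ℤ Λ := ZLattice.module_free ℝ Λ
  -- A ℤ-basis of a full-rank lattice is a real basis of phase space.
  obtain ⟨n, B, hB⟩ : ∃ (n : ℕ) (B : Module.Basis (Fin n) ℝ (ModInv.Phase d)),
      ModInv.latticeOf B = Λ :=
    ⟨_, _, Module.Basis.ofZLatticeBasis_span ℝ Λ (Module.finBasis ℤ Λ)⟩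
  subst hB
  exact ModInv.spreading_function_calculus S T hS hT hΛ
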